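/- Let $H$ denote Shannon entropy with natural logarithms. For a finite abelian group $G$ and $x,y\in[0,\log|G|]$ let $f_G(x,y)$ be the minimum of $H(X+Y)$ over all pairs of independent $G$-valued random variables $X,Y$ with $H(X)=x$ and $H(Y)=y$. Let $h(p)=-p\log p-(1-p)\log(1-p)$, let $h^{-1}:[0,\log 2]\to[0,\tfrac12]$ be the inverse of $h$ restricted to $[0,\tfrac12]$, and let $a\star b=a(1-b)+(1-a)b$. **Theorem.** Let $n\ge 0$ and let $G$ be an abelian group of order $2^n$. 1. For all $x,y\in[0,n\log 2]$ the minimum $f_G(x,y)$ is attained and $f_G(x,y)=f_{\mathbb{Z}/2^n\mathbb{Z}}(x,y)$. In particular $f_{G'}=f_G$ for every abelian group $G'$ of the same order. 2. Explicitly, for $x,y\in[0,n\log 2]$, $$f_G(x,y)=\begin{cases} f_{\mathbb{Z}/2\mathbb{Z}}(x-k\log 2,\,y-k\log 2)+k\log 2, & \text{if } k\log 2\le x,y\le (k+1)\log 2 \text{ for some integer } k\ge 0,\\ \max(x,y), & \text{otherwise,}\end{cases}$$ where $f_{\mathbb{Z}/2\mathbb{Z}}(u,v)=h\big(h^{-1}(u)\star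 h^{-1}(v)\big)$ for $u,v\in[0,\log 2]$. Consequently all independent $G$-valued $X,Y$ satisfy $H(X+Y)\ge f_G(H(X),H(Y))$. 3. $G$ has a chain of subgroups $G_0\le G_1\le\dots\le G_n=G$ with $|G_k|=2^k$. For every such chain, all $0\le k,j<n$, all $x\in[k\log 2,(k+1)\log 2]$ and all $y\in[j\log 2,(j+1)\log 2]$, there are independent $X,Y$ with $H(X)=x$, $H(Y)=y$ such that $X$ is supported on $G_{k+1}$ with law constant on each of the two cosets of $G_k$ in $G_{k+1}$, and $Y$ is supported on $G_{j+1}$ with law constant on each of the two cosets of $G_j$ in $G_{j+1}$; and every such pair attains the minimum, $H(X+Y)=f_G(x,y)$. -/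

import Mathlib

open MeasureTheory ProbabilityTheory

noncomputable section

/-- Shannon entropy (natural logarithm) of a random variable `X` with values in a finite set:
`H(X) = - ∑ g, P(X = g) log P(X = g)`, with `0 log 0 = 0`. -/
def shannonEntropy {Ω : Type*} [MeasurableSpace Ω] (P : Measure Ω) {G : Type*} [Fintype G]
    (X : Ω → G) : ℝ :=
  ∑ g, Real.negMulLog (P.real (X ⁻¹' {g}))

/-- `X` and `Y` are independent random variables with values in `G`, where `G` carries the discrete
σ-algebra. -/
def IsIndepPair {Ω : Type*} [MeasurableSpace Ω] (P : Measure Ω) {G : Type*}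
    (X Y : Ω → G) : Prop :=
  letI : MeasurableSpace G := ⊤
  Measurable X ∧ Measurable Y ∧ IndepFun X Y P

/-- The set of all values `H(X + Y)`, over independent `G`-valued random variables `X`, `Y` (on an
arbitrary probability space) with `H(X) = x` and `H(Y) = y`. -/
def sumEntropies (G : Type*) [AddCommGroup G] [Fintype G] (x y : ℝ) : Set ℝ :=
  {s | ∃ (Ω : Type) (_ : MeasurableSpace Ω) (P : Measure Ω) (X Y : Ω → G),
      IsProbabilityMeasure P ∧ IsIndepPair P X Y ∧
      shannonEntropy P X = x ∧ shannonEntropy P Y = y ∧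
      shannonEntropy P (fun ω => X ω + Y ω) = s}

/-- The function `f_G(x, y) = min {H(X + Y) : H(X) = x, H(Y) = y}`. (That the infimum is a minimum
for `x`, `y` in the range of the entropy is part of what is claimed.) -/
def minSumEntropy (G : Type*) [AddCommGroup G] [Fintype G] (x y : ℝ) : ℝ :=
  sInf (sumEntropies G x y)

/-- The inverse `h⁻¹ : [0, log 2] → [0, 1/2]` of the binary entropy function `h`, which is a
bijection from `[0, 1/2]` onto `[0, log 2]`. -/
def binEntropyInv (u : ℝ) : ℝ :=
  Function.invFunOn Real.binEntropy (Set.Icc 0 (1 / 2)) u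

/-- Binary convolution `a ⋆ b = a (1 - b) + (1 - a) b`. -/
def binConv (a b : ℝ) : ℝ := a * (1 - b) + (1 - a) * b

/-- The law of `X` is supported on the subgroup `K` and is constant on each coset of `L`
inside `K`. -/
def IsUniformOnCosets {Ω : Type*} [MeasurableSpace Ω] (P : Measure Ω) {G : Type*} [AddCommGroup G]
    (X : Ω → G) (L K : AddSubgroup G) : Prop :=
  (∀ g, g ∉ K → P.real (X ⁻¹' {g}) = 0) ∧
  ∀ g ∈ K, ∀ l ∈ L, P.real (X ⁻¹' {g + l}) = P.real (X ⁻¹' {g})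

/-- The interval `[k log 2, (k + 1) log 2]`. -/
def logBox (k : ℕ) : Set ℝ := Set.Icc ((k : ℝ) * Real.log 2) (((k : ℝ) + 1) * Real.log 2)

end

/-!
# The minimal entropy of a sum in an abelian group of order `2 ^ n`

Write `f (u, v) = h (h⁻¹ u ⋆ h⁻¹ v)` (`gerber`) for the group of order two, and let `F`
(`gerberExt`) be its explicit extension to all nonnegative entropies: a translate of `f` on each
diagonal box of side `log 2`, and the maximum elsewhere.

*Lower bound.* The inequality `H (X + Y) ≥ F (H X, H Y)` is proved by induction over a subgroup `K`
of index two (`EntropyBound.of_index_two`). The chain rule splits `H (X + Y)` into the entropy of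
the coset of `X + Y`, which equals `f (u, v)` for the entropies `u`, `v` of the cosets of `X` and
`Y`, and a conditional entropy. The latter only decreases when the cosets of `X` and `Y` are both
given, so the induction hypothesis bounds it from below by an average of values of `F`, hence by
`F (H X - u, H Y - v)`, because `F` is convex in each variable. This convexity is Mrs. Gerber's
Lemma (`gerber_support`, `gerberExt_support`). What remains is the purely analytic inequality
`F (u + a, v + b) ≤ f (u, v) + F (a, b)` (`gerberExt_add_le`).

*The analytic inequality.* By translation and monotonicity it is enough to treat
`u, v, a, b ∈ [0, log 2]` (`gerberExt_add_le_of_unit`). Minimize the right-hand side over all such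
splittings of a given pair. At an edge of the domain the inequality follows from monotonicity, the
Lipschitz property and translation. There is no interior minimum (`not_forall_isLocalMin`):
stationarity says that the gradients of `f` at `(u, v)` and `(a, b)` agree, the gradient of `f` is
injective (`gradient_injective`), and at a coinciding point the Hessian of `f` has a negative
direction (`exists_hasDerivAt_gerberDeriv_neg`). With `φ s = s * artanh s`, `s = 1 - 2 h⁻¹ u` and
`t = 1 - 2 h⁻¹ v`, the gradient of `f` is `(φ (s t) / φ s, φ (s t) / φ t)`, and both facts about it
follow from the monotonicity of `-log s * s * φ' s / φ s` (`neg_log_mul_phiElast_strictAntiOn`).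

*Attainment.* For laws supported on `G_{k+1}` and constant on the cosets of `G_k`, the sum is
computed in the two-element group `G_{k+1} / G_k` if both laws live at the same level; otherwise the
law at the higher level absorbs the other one (`entropy_conv_chain`).
-/


noncomputable section

namespace MrsGerber

open Set Real

/-! ### Estimates for the inverse hyperbolic tangent -/

lemma hasDerivAt_artanh {s : ℝ} (hs : s ∈ Ioo (-1 : ℝ) 1) :
    HasDerivAt artanh (1 / (1 - s ^ 2)) s := by
  have h1 : 0 < 1 - s := by linarith [hs.2]
  have h2 : 0 < 1 + s := by linarith [hs.1]
  have h : HasDerivAt (fun x : ℝ => 1 / 2 * Real.log ((1 + x) / (1 - x))) (1 / (1 - s ^ 2)) s := by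
    have hd : HasDerivAt (fun x : ℝ => (1 + x) / (1 - x))
        ((1 * (1 - s) - (1 + s) * (-1)) / (1 - s) ^ 2) s :=
      ((hasDerivAt_id s).const_add 1).div ((hasDerivAt_id s).const_sub 1) h1.ne'
    refine ((hd.log (by positivity)).const_mul (1 / 2)).congr_deriv ?_
    have : (1 - s ^ 2) ≠ 0 := by nlinarith
    field_simp
    ring
  refine h.congr_of_eventuallyEq ?_
  filter_upwards [Ioo_mem_nhds hs.1 hs.2] with x hx
  exact artanh_eq_half_log ⟨hx.1.le, hx.2.le⟩

lemma artanh_le_div {s : ℝ} (hs : s ∈ Ioo (0 : ℝ) 1) : artanh s ≤ s / (1 - s ^ 2) := by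
  have h1 : 0 < 1 - s := by linarith [hs.2]
  have h2 : 0 < 1 + s := by linarith [hs.1]
  have hz : 1 ≤ (1 + s) / (1 - s) := by rw [one_le_div h1]; linarith [hs.1]
  rw [artanh_eq_half_log ⟨by linarith [hs.1], hs.2.le⟩]
  have h := self_le_sinh_iff.2 (Real.log_nonneg hz)
  rw [sinh_log (by positivity)] at h
  have e : ((1 + s) / (1 - s) - ((1 + s) / (1 - s))⁻¹) / 2 = 2 * (s / (1 - s ^ 2)) := by
    have : (1 - s ^ 2) ≠ 0 := by nlinarith
    field_simp
    ring
  linarith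

lemma le_artanh {s : ℝ} (hs : s ∈ Ico (0 : ℝ) 1) : s ≤ artanh s := by
  have hd : ∀ x ∈ Ico (0 : ℝ) 1, HasDerivAt (fun x => artanh x - x) (1 / (1 - x ^ 2) - 1) x :=
    fun x hx => (hasDerivAt_artanh ⟨by linarith [hx.1], hx.2⟩).sub (hasDerivAt_id x)
  have hm : MonotoneOn (fun x => artanh x - x) (Ico (0 : ℝ) 1) := by
    refine monotoneOn_of_deriv_nonneg (convex_Ico 0 1)
      (fun x hx => (hd x hx).continuousAt.continuousWithinAt) ?_ ?_
    · exact fun x hx => (hd x (interior_subset hx)).differentiableAt.differentiableWithinAt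
    · intro x hx
      have hx' := interior_subset hx
      rw [(hd x hx').deriv, sub_nonneg, le_div_iff₀ (by nlinarith [hx'.1, hx'.2])]
      nlinarith [sq_nonneg x]
  simpa using hm ⟨le_rfl, one_pos⟩ hs hs.1

/-- `log (1 / s) ≤ (1 / s - s) / 2`. -/
lemma neg_log_le {s : ℝ} (hs : s ∈ Ioo (0 : ℝ) 1) : -Real.log s ≤ (1 - s ^ 2) / (2 * s) := by
  have h := self_le_sinh_iff.2 (Real.log_nonneg ((one_le_inv₀ hs.1).2 hs.2.le))
  rw [sinh_log (inv_pos.2 hs.1), Real.log_inv, inv_inv] at h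
  have e : (s⁻¹ - s) / 2 = (1 - s ^ 2) / (2 * s) := by
    have := hs.1.ne'
    field_simp
  linarith

/-- The function `φ s = s * artanh s`. If `s = 1 - 2p`, `t = 1 - 2q`, the partial derivatives of
`h (h⁻¹ u ⋆ h⁻¹ v)` at `u = h p`, `v = h q` are `φ (s * t) / φ s` and `φ (s * t) / φ t`. -/
def phi (s : ℝ) : ℝ := s * artanh s

/-- The logarithmic derivative `s * φ' s / φ s` of `phi`. -/
def phiElast (s : ℝ) : ℝ := 1 + s / ((1 - s ^ 2) * artanh s)

lemma phi_pos {s : ℝ} (hs : s ∈ Ioo (0 : ℝ) 1) : 0 < phi s := mul_pos hs.1 (artanh_pos hs)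

lemma phiElast_pos {s : ℝ} (hs : s ∈ Ioo (0 : ℝ) 1) : 0 < phiElast s := by
  have h1 := artanh_pos hs
  have h2 : 0 < 1 - s ^ 2 := by nlinarith [hs.1, hs.2]
  have := hs.1
  unfold phiElast
  positivity

lemma hasDerivAt_phi {s : ℝ} (hs : s ∈ Ioo (0 : ℝ) 1) :
    HasDerivAt phi (phiElast s * phi s / s) s := by
  have h := (hasDerivAt_id s).mul (hasDerivAt_artanh ⟨by linarith [hs.1], hs.2⟩)
  have h1 := (artanh_pos hs).ne'
  have h2 : 1 - s ^ 2 ≠ 0 := by nlinarith [hs.1, hs.2]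
  have h3 := hs.1.ne'
  refine h.congr_deriv ?_
  simp only [phiElast, phi, id]
  field_simp

lemma phi_strictMonoOn : StrictMonoOn phi (Ioo 0 1) := by
  refine strictMonoOn_of_deriv_pos (convex_Ioo 0 1)
    (fun x hx => (hasDerivAt_phi hx).continuousAt.continuousWithinAt) fun x hx => ?_
  rw [interior_Ioo] at hx
  rw [(hasDerivAt_phi hx).deriv]
  exact div_pos (mul_pos (phiElast_pos hx) (phi_pos hx)) hx.1

lemma hasDerivAt_phiElast {s : ℝ} (hs : s ∈ Ioo (0 : ℝ) 1) :
    HasDerivAt phiElast (((1 + s ^ 2) * artanh s - s) / ((1 - s ^ 2) * artanh s) ^ 2) s := by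
  have h1 := (artanh_pos hs).ne'
  have h2 : 1 - s ^ 2 ≠ 0 := by nlinarith [hs.1, hs.2]
  have hd : HasDerivAt (fun x : ℝ => (1 - x ^ 2) * artanh x)
      (-(2 * s) * artanh s + (1 - s ^ 2) * (1 / (1 - s ^ 2))) s := by
    have h := (((hasDerivAt_id s).pow 2).const_sub 1).mul
      (hasDerivAt_artanh (s := s) ⟨by linarith [hs.1], hs.2⟩)
    refine h.congr_deriv ?_
    simp
  have h := ((hasDerivAt_id s).div hd (mul_ne_zero h2 h1)).const_add 1
  refine h.congr_deriv ?_
  simp only [id]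
  congr 1
  field_simp
  ring

lemma phiElast_monotoneOn : MonotoneOn phiElast (Ioo 0 1) := by
  refine monotoneOn_of_deriv_nonneg (convex_Ioo 0 1)
    (fun x hx => (hasDerivAt_phiElast hx).continuousAt.continuousWithinAt)
    (fun x hx => (hasDerivAt_phiElast (interior_subset hx)).differentiableAt.differentiableWithinAt)
    fun x hx => ?_
  rw [interior_Ioo] at hx
  rw [(hasDerivAt_phiElast hx).deriv]
  refine div_nonneg ?_ (sq_nonneg _)
  have := le_artanh ⟨hx.1.le, hx.2⟩
  nlinarith [sq_nonneg x, hx.1]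

/-- Equivalently, by the chain rule, `c ↦ log (φ (exp (-exp c)))` is strictly concave: this
is the one quantitative fact about `φ` behind both the injectivity of the gradient of `gerber` and
the indefiniteness of its Hessian. -/
lemma neg_log_mul_phiElast_strictAntiOn :
    StrictAntiOn (fun s => -Real.log s * phiElast s) (Ioo 0 1) := by
  have hd : ∀ s ∈ Ioo (0 : ℝ) 1, HasDerivAt (fun s => -Real.log s * phiElast s)
      (-s⁻¹ * phiElast s + -Real.log s *
        (((1 + s ^ 2) * artanh s - s) / ((1 - s ^ 2) * artanh s) ^ 2)) s :=
    fun s hs => (Real.hasDerivAt_log hs.1.ne').neg.mul (hasDerivAt_phiElast hs)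
  refine strictAntiOn_of_deriv_neg (convex_Ioo 0 1)
    (fun x hx => (hd x hx).continuousAt.continuousWithinAt) fun s hs => ?_
  rw [interior_Ioo] at hs
  rw [(hd s hs).deriv]
  have hs0 := hs.1
  have hA := artanh_pos hs
  have h2 : 0 < 1 - s ^ 2 := by nlinarith [hs.1, hs.2]
  have hle := le_artanh ⟨hs.1.le, hs.2⟩
  have hup := artanh_le_div hs
  rw [le_div_iff₀ h2] at hup
  have hN : 0 ≤ (1 + s ^ 2) * artanh s - s := by nlinarith [sq_nonneg s]
  have h3 : -Real.log s * (((1 + s ^ 2) * artanh s - s) / ((1 - s ^ 2) * artanh s) ^ 2) ≤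
      (1 - s ^ 2) / (2 * s) * (((1 + s ^ 2) * artanh s - s) / ((1 - s ^ 2) * artanh s) ^ 2) :=
    mul_le_mul_of_nonneg_right (neg_log_le hs) (by positivity)
  refine (add_le_add_right h3 _).trans_lt ?_
  have e : -s⁻¹ * phiElast s +
      (1 - s ^ 2) / (2 * s) * (((1 + s ^ 2) * artanh s - s) / ((1 - s ^ 2) * artanh s) ^ 2) =
      (((1 + s ^ 2) * artanh s - s) - 2 * artanh s * ((1 - s ^ 2) * artanh s + s)) /
        (2 * s * (1 - s ^ 2) * artanh s ^ 2) := by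
    unfold phiElast
    field_simp
    ring
  rw [e]
  refine div_neg_of_neg_of_pos ?_ (by positivity)
  nlinarith [mul_pos hA hs0, mul_pos hA h2, mul_nonneg hA.le (sub_nonneg.2 hup), hs.2,
    mul_pos (mul_pos hA hs0) (sub_pos.2 hs.2)]

/-- Monotonicity of `s ↦ artanh (s * t) / artanh s`, the analytic form of Mrs. Gerber's Lemma. -/
lemma artanh_mul_le {s s' t : ℝ} (hs : s ∈ Ioo (0 : ℝ) 1) (hs' : s' ∈ Ioo (0 : ℝ) 1)
    (ht : t ∈ Ioo (0 : ℝ) 1) (h : s ≤ s') :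
    artanh (s' * t) * artanh s ≤ artanh (s * t) * artanh s' := by
  have hmem : ∀ x ∈ Ioo (0 : ℝ) 1, x * t ∈ Ioo (0 : ℝ) 1 := fun x hx =>
    ⟨mul_pos hx.1 ht.1, by nlinarith [hx.1, hx.2, ht.1, ht.2]⟩
  have hd : ∀ x ∈ Ioo (0 : ℝ) 1, HasDerivAt (fun x => artanh (x * t) / artanh x)
      ((1 / (1 - (x * t) ^ 2) * t * artanh x - artanh (x * t) * (1 / (1 - x ^ 2))) /
        artanh x ^ 2) x := by
    intro x hx
    have h1 : HasDerivAt (fun x => artanh (x * t)) (1 / (1 - (x * t) ^ 2) * t) x :=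
      HasDerivAt.comp (h₂ := artanh) x
        (hasDerivAt_artanh ⟨by linarith [(hmem x hx).1], (hmem x hx).2⟩) (hasDerivAt_mul_const t)
    exact h1.div (hasDerivAt_artanh ⟨by linarith [hx.1], hx.2⟩) (artanh_pos hx).ne'
  have hm : AntitoneOn (fun x => artanh (x * t) / artanh x) (Ioo (0 : ℝ) 1) := by
    refine antitoneOn_of_deriv_nonpos (convex_Ioo 0 1)
      (fun x hx => (hd x hx).continuousAt.continuousWithinAt)
      (fun x hx => (hd x (interior_subset hx)).differentiableAt.differentiableWithinAt)
      fun x hx => ?_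
    rw [interior_Ioo] at hx
    rw [(hd x hx).deriv]
    refine div_nonpos_of_nonpos_of_nonneg ?_ (sq_nonneg _)
    have hw := phiElast_monotoneOn (hmem x hx) hx (by nlinarith [hx.1, ht.2])
    unfold phiElast at hw
    have a1 := artanh_pos hx
    have a2 := artanh_pos (hmem x hx)
    have b1 : 0 < 1 - x ^ 2 := by nlinarith [hx.1, hx.2]
    have b2 : 0 < 1 - (x * t) ^ 2 := by nlinarith [(hmem x hx).1, (hmem x hx).2]
    have hw' : x * t / ((1 - (x * t) ^ 2) * artanh (x * t)) ≤ x / ((1 - x ^ 2) * artanh x) := by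
      linarith
    rw [div_le_div_iff₀ (by positivity) (by positivity)] at hw'
    rw [sub_nonpos, one_div, one_div, inv_mul_eq_div, div_mul_eq_mul_div, ← div_eq_mul_inv,
      div_le_div_iff₀ b2 b1]
    refine le_of_mul_le_mul_left ?_ hx.1
    linarith
  have := hm hs hs' h
  rwa [div_le_div_iff₀ (artanh_pos hs') (artanh_pos hs)] at this

lemma rpow_mem {r κ : ℝ} (hr : r ∈ Ioo (0 : ℝ) 1) (hκ : 0 < κ) : r ^ κ ∈ Ioo (0 : ℝ) 1 :=
  ⟨rpow_pos_of_pos hr.1 _, rpow_lt_one hr.1.le hr.2 hκ⟩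

lemma phi_rpow_div_strictMonoOn {κ : ℝ} (hκ : 1 < κ) :
    StrictMonoOn (fun r => phi (r ^ κ) / phi r) (Ioo 0 1) := by
  have hκ0 : 0 < κ := by linarith
  have hd : ∀ r ∈ Ioo (0 : ℝ) 1, HasDerivAt (fun r => phi (r ^ κ) / phi r)
      ((phiElast (r ^ κ) * phi (r ^ κ) / r ^ κ * (κ * r ^ (κ - 1)) * phi r -
        phi (r ^ κ) * (phiElast r * phi r / r)) / phi r ^ 2) r := by
    intro r hr
    exact ((hasDerivAt_phi (rpow_mem hr hκ0)).comp r
      (Real.hasDerivAt_rpow_const (Or.inl hr.1.ne'))).div (hasDerivAt_phi hr) (phi_pos hr).ne'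
  refine strictMonoOn_of_deriv_pos (convex_Ioo 0 1)
    (fun x hx => (hd x hx).continuousAt.continuousWithinAt) fun r hr => ?_
  rw [interior_Ioo] at hr
  rw [(hd r hr).deriv]
  have hr0 := hr.1
  have p1 := phi_pos hr
  have p2 := phi_pos (rpow_mem hr hκ0)
  have hlt : r ^ κ < r := by
    simpa using rpow_lt_rpow_of_exponent_gt hr.1 hr.2 hκ
  have hM := neg_log_mul_phiElast_strictAntiOn (rpow_mem hr hκ0) hr hlt
  simp only [Real.log_rpow hr0] at hM
  have hl : 0 < -Real.log r := by linarith [Real.log_neg hr.1 hr.2]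
  have hw : phiElast r < κ * phiElast (r ^ κ) := by
    refine lt_of_mul_lt_mul_left ?_ hl.le
    linarith
  have e : phiElast (r ^ κ) * phi (r ^ κ) / r ^ κ * (κ * r ^ (κ - 1)) * phi r -
      phi (r ^ κ) * (phiElast r * phi r / r) =
      phi (r ^ κ) * phi r / r * (κ * phiElast (r ^ κ) - phiElast r) := by
    rw [rpow_sub_one hr0.ne']
    have := (rpow_pos_of_pos hr0 κ).ne'
    field_simp
  rw [e]
  have := sub_pos.2 hw
  positivity

lemma mul_mem_Ioo {s t : ℝ} (hs : s ∈ Ioo (0 : ℝ) 1) (ht : t ∈ Ioo (0 : ℝ) 1) :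
    s * t ∈ Ioo (0 : ℝ) 1 :=
  ⟨mul_pos hs.1 ht.1, by nlinarith [hs.1, hs.2, ht.1, ht.2]⟩

/-- Along a curve on which `φ s / φ t` is constant, `φ (s * t) / φ s` is strictly increasing. Here
`s = s' ^ κ` and `t = t' ^ μ` with `κ ≤ μ`, hence `s * t ≤ (s' * t') ^ κ`. -/
lemma phi_mul_lt_aux {s t s' t' κ μ : ℝ} (hs' : s' ∈ Ioo (0 : ℝ) 1)
    (ht' : t' ∈ Ioo (0 : ℝ) 1) (hκ : 1 < κ) (hκμ : κ ≤ μ) (hs : s = s' ^ κ) (ht : t = t' ^ μ) :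
    phi (s * t) * phi s' < phi (s' * t') * phi s := by
  have hκ0 : 0 < κ := by linarith
  have hμ0 : 0 < μ := by linarith
  have hst := mul_mem_Ioo (rpow_mem hs' hκ0) (rpow_mem ht' hμ0)
  have hr := mul_mem_Ioo hs' ht'
  have h1 : s' ^ κ * t' ^ μ ≤ (s' * t') ^ κ := by
    rw [mul_rpow hs'.1.le ht'.1.le]
    exact mul_le_mul_of_nonneg_left (rpow_le_rpow_of_exponent_ge ht'.1 ht'.2.le hκμ)
      (rpow_pos_of_pos hs'.1 _).le
  have h2 := phi_strictMonoOn.monotoneOn hst (rpow_mem hr hκ0) h1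
  have h3 := phi_rpow_div_strictMonoOn hκ hr hs' (by nlinarith [hs'.1, ht'.2])
  simp only at h3
  rw [div_lt_div_iff₀ (phi_pos hr) (phi_pos hs')] at h3
  rw [hs, ht]
  have := mul_le_mul_of_nonneg_right h2 (phi_pos hs').le
  linarith

lemma phi_mul_lt {s t s' t' : ℝ} (hs : s ∈ Ioo (0 : ℝ) 1)
    (ht : t ∈ Ioo (0 : ℝ) 1) (hs' : s' ∈ Ioo (0 : ℝ) 1) (ht' : t' ∈ Ioo (0 : ℝ) 1)
    (hss : s < s') (h : phi s * phi t' = phi s' * phi t) :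
    phi (s * t) * phi s' < phi (s' * t') * phi s := by
  have htt : t < t' := by
    by_contra! hle
    have h1 := phi_strictMonoOn.monotoneOn ht' ht hle
    have h2 := phi_strictMonoOn hs hs' hss
    nlinarith [phi_pos hs, phi_pos hs', phi_pos ht, phi_pos ht']
  have key : ∀ a b : ℝ, a ∈ Ioo (0 : ℝ) 1 → b ∈ Ioo (0 : ℝ) 1 → a < b →
      ∃ κ : ℝ, 1 < κ ∧ a = b ^ κ := by
    intro a b ha hb hab
    have l1 := Real.log_neg ha.1 ha.2
    have l2 := Real.log_neg hb.1 hb.2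
    have l3 := Real.log_lt_log ha.1 hab
    refine ⟨Real.log a / Real.log b, by rw [lt_div_iff_of_neg l2]; linarith, ?_⟩
    rw [rpow_def_of_pos hb.1, mul_div_cancel₀ _ l2.ne, Real.exp_log ha.1]
  obtain ⟨κ, hκ, e1⟩ := key s s' hs hs' hss
  obtain ⟨μ, hμ, e2⟩ := key t t' ht ht' htt
  rcases le_total κ μ with hle | hle
  · exact phi_mul_lt_aux hs' ht' hκ hle e1 e2
  · have h3 := phi_mul_lt_aux ht' hs' hμ hle e2 e1
    rw [mul_comm t s, mul_comm t' s'] at h3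
    -- the roles of `s` and `t` may be exchanged because `φ s / φ s' = φ t / φ t'`
    refine lt_of_mul_lt_mul_right ?_ (phi_pos ht').le
    calc phi (s * t) * phi s' * phi t' = phi (s * t) * phi t' * phi s' := by ring
      _ < phi (s' * t') * phi t * phi s' := mul_lt_mul_of_pos_right h3 (phi_pos hs')
      _ = phi (s' * t') * phi s * phi t' := by rw [mul_assoc, mul_comm (phi t), ← h]; ring

/-- Injectivity of the gradient of `gerber`, in the coordinates `s = 1 - 2p`, `t = 1 - 2q`. -/
lemma gradient_injective {s t s' t' : ℝ} (hs : s ∈ Ioo (0 : ℝ) 1)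
    (ht : t ∈ Ioo (0 : ℝ) 1) (hs' : s' ∈ Ioo (0 : ℝ) 1) (ht' : t' ∈ Ioo (0 : ℝ) 1)
    (h1 : phi (s * t) / phi s = phi (s' * t') / phi s')
    (h2 : phi (s * t) / phi t = phi (s' * t') / phi t') : s = s' ∧ t = t' := by
  have p1 := phi_pos hs
  have p2 := phi_pos ht
  have p3 := phi_pos hs'
  have p4 := phi_pos ht'
  have p5 := phi_pos (mul_mem_Ioo hs ht)
  have p6 := phi_pos (mul_mem_Ioo hs' ht')
  rw [div_eq_div_iff p1.ne' p3.ne'] at h1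
  rw [div_eq_div_iff p2.ne' p4.ne'] at h2
  have h : phi s * phi t' = phi s' * phi t := by
    have : phi (s * t) * phi (s' * t') * (phi s * phi t') =
        phi (s * t) * phi (s' * t') * (phi s' * phi t) := by
      linear_combination (phi (s' * t') * phi s) * h2 - (phi (s' * t') * phi t) * h1
    exact mul_left_cancel₀ (mul_pos p5 p6).ne' this
  have hss : s = s' := by
    rcases lt_trichotomy s s' with hlt | heq | hgt
    · exact absurd h1 (phi_mul_lt hs ht hs' ht' hlt h).ne
    · exact heq
    · exact absurd h1.symm (phi_mul_lt hs' ht' hs ht hgt h.symm).ne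
  subst hss
  exact ⟨rfl, (phi_strictMonoOn.injOn ht ht' (mul_left_cancel₀ p1.ne' h.symm))⟩

/-- Along the direction in which `φ s / φ t` is stationary, `φ (s * t) / φ s` increases. -/
lemma one_lt_phiElast_mul {s t : ℝ} (hs : s ∈ Ioo (0 : ℝ) 1) (ht : t ∈ Ioo (0 : ℝ) 1) :
    1 < phiElast (s * t) * ((phiElast s)⁻¹ + (phiElast t)⁻¹) := by
  have hst := mul_mem_Ioo hs ht
  have m1 := neg_log_mul_phiElast_strictAntiOn hst hs (by nlinarith [hs.1, ht.2])
  have m2 := neg_log_mul_phiElast_strictAntiOn hst ht (by nlinarith [hs.2, ht.1])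
  simp only [Real.log_mul hs.1.ne' ht.1.ne'] at m1 m2
  have w1 := phiElast_pos hs
  have w2 := phiElast_pos ht
  have l1 : 0 < -Real.log s := by linarith [Real.log_neg hs.1 hs.2]
  have l2 : 0 < -Real.log t := by linarith [Real.log_neg ht.1 ht.2]
  have k1 : -Real.log s < -(Real.log s + Real.log t) * phiElast (s * t) * (phiElast s)⁻¹ := by
    rwa [← div_eq_mul_inv, lt_div_iff₀ w1]
  have k2 : -Real.log t < -(Real.log s + Real.log t) * phiElast (s * t) * (phiElast t)⁻¹ := by
    rwa [← div_eq_mul_inv, lt_div_iff₀ w2]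
  refine lt_of_mul_lt_mul_left (a := -(Real.log s + Real.log t)) ?_ (by linarith)
  linarith

/-! ### Binary entropy in terms of the bias, and Mrs. Gerber's function -/

/-- The binary entropy of a coin with bias `s`, that is, with probabilities `(1 ± s) / 2`. In this
coordinate the binary convolution becomes multiplication. -/
def biasEntropy (s : ℝ) : ℝ := binEntropy ((1 - s) / 2)

/-- The bias `s ∈ [0, 1]` of a coin with entropy `u`. -/
def bias (u : ℝ) : ℝ := 1 - 2 * binEntropyInv u

/-- The function `(u, v) ↦ h (h⁻¹ u ⋆ h⁻¹ v)` of Mrs. Gerber's Lemma. -/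
def gerber (u v : ℝ) : ℝ := binEntropy (binConv (binEntropyInv u) (binEntropyInv v))

lemma biasEntropy_zero : biasEntropy 0 = Real.log 2 := by
  rw [biasEntropy, show (1 - 0 : ℝ) / 2 = 2⁻¹ by norm_num, binEntropy_two_inv]

lemma biasEntropy_one : biasEntropy 1 = 0 := by simp [biasEntropy]

@[fun_prop]
lemma continuous_biasEntropy : Continuous biasEntropy := by
  unfold biasEntropy
  fun_prop

lemma biasEntropy_strictAntiOn : StrictAntiOn biasEntropy (Icc 0 1) := by
  intro a ha b hb hab
  exact binEntropy_strictMonoOn ⟨by linarith [hb.2], by linarith [hb.1]⟩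
    ⟨by linarith [ha.2], by linarith [ha.1]⟩ (by linarith)

lemma biasEntropy_le {s t : ℝ} (hs : 0 ≤ s) (hst : s ≤ t) (ht : t ≤ 1) :
    biasEntropy t ≤ biasEntropy s :=
  biasEntropy_strictAntiOn.antitoneOn ⟨hs, hst.trans ht⟩ ⟨hs.trans hst, ht⟩ hst

lemma biasEntropy_mem {s : ℝ} (hs : s ∈ Icc (0 : ℝ) 1) : biasEntropy s ∈ Icc 0 (Real.log 2) :=
  ⟨biasEntropy_one ▸ biasEntropy_le hs.1 hs.2 le_rfl,
    biasEntropy_zero ▸ biasEntropy_le le_rfl hs.1 hs.2⟩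

lemma hasDerivAt_biasEntropy {s : ℝ} (hs : s ∈ Ioo (-1 : ℝ) 1) :
    HasDerivAt biasEntropy (-artanh s) s := by
  have h1 : 0 < 1 - s := by linarith [hs.2]
  have h2 : 0 < 1 + s := by linarith [hs.1]
  have hd : HasDerivAt (fun s : ℝ => (1 - s) / 2) (-1 / 2) s :=
    ((hasDerivAt_id s).const_sub 1).div_const 2
  have h := HasDerivAt.comp (h₂ := binEntropy) s
    (hasDerivAt_binEntropy (p := (1 - s) / 2) (by positivity) (by linarith)) hd
  refine h.congr_deriv ?_
  rw [artanh_eq_half_log ⟨hs.1.le, hs.2.le⟩, Real.log_div h2.ne' h1.ne',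
    show 1 - (1 - s) / 2 = (1 + s) / 2 by ring, Real.log_div h2.ne' two_ne_zero,
    Real.log_div h1.ne' two_ne_zero]
  ring

lemma binEntropyInv_spec {u : ℝ} (hu : u ∈ Icc 0 (Real.log 2)) :
    binEntropyInv u ∈ Icc (0 : ℝ) (1 / 2) ∧ binEntropy (binEntropyInv u) = u := by
  have h : ∃ p ∈ Icc (0 : ℝ) (1 / 2), binEntropy p = u := by
    have := intermediate_value_Icc (show (0 : ℝ) ≤ 1 / 2 by norm_num)
      binEntropy_continuous.continuousOn
    rw [binEntropy_zero, one_div, binEntropy_two_inv] at this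
    rw [one_div]
    exact this hu
  exact ⟨Function.invFunOn_mem h, Function.invFunOn_eq h⟩

lemma bias_mem {u : ℝ} (hu : u ∈ Icc 0 (Real.log 2)) : bias u ∈ Icc (0 : ℝ) 1 := by
  have := (binEntropyInv_spec hu).1
  exact ⟨by unfold bias; linarith [this.2], by unfold bias; linarith [this.1]⟩

lemma biasEntropy_bias {u : ℝ} (hu : u ∈ Icc 0 (Real.log 2)) : biasEntropy (bias u) = u := by
  rw [biasEntropy, bias, show (1 - (1 - 2 * binEntropyInv u)) / 2 = binEntropyInv u by ring]
  exact (binEntropyInv_spec hu).2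

lemma bias_biasEntropy {s : ℝ} (hs : s ∈ Icc (0 : ℝ) 1) : bias (biasEntropy s) = s :=
  biasEntropy_strictAntiOn.injOn (bias_mem (biasEntropy_mem hs)) hs
    (biasEntropy_bias (biasEntropy_mem hs))

lemma bias_injOn : InjOn bias (Icc 0 (Real.log 2)) := fun u hu v hv h => by
  rw [← biasEntropy_bias hu, ← biasEntropy_bias hv, h]

lemma bias_zero : bias 0 = 1 := by
  rw [← biasEntropy_one, bias_biasEntropy ⟨zero_le_one, le_rfl⟩]

lemma bias_log_two : bias (Real.log 2) = 0 := by
  rw [← biasEntropy_zero, bias_biasEntropy ⟨le_rfl, zero_le_one⟩]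

lemma log_two_nonneg : (0 : ℝ) ≤ Real.log 2 := Real.log_nonneg one_le_two

lemma log_two_pos : (0 : ℝ) < Real.log 2 := Real.log_pos one_lt_two

lemma bias_strictAntiOn : StrictAntiOn bias (Icc 0 (Real.log 2)) := fun u hu v hv h => by
  by_contra! hle
  have := biasEntropy_le (bias_mem hu).1 hle (bias_mem hv).2
  rw [biasEntropy_bias hu, biasEntropy_bias hv] at this
  linarith

lemma bias_mem_Ioo {u : ℝ} (hu : u ∈ Ioo 0 (Real.log 2)) : bias u ∈ Ioo (0 : ℝ) 1 := by
  have h0 : (0 : ℝ) ∈ Icc 0 (Real.log 2) := ⟨le_rfl, log_two_nonneg⟩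
  have h1 : Real.log 2 ∈ Icc 0 (Real.log 2) := ⟨log_two_nonneg, le_rfl⟩
  exact ⟨bias_log_two ▸ bias_strictAntiOn (Ioo_subset_Icc_self hu) h1 hu.2,
    bias_zero ▸ bias_strictAntiOn h0 (Ioo_subset_Icc_self hu) hu.1⟩

lemma continuousAt_bias {u : ℝ} (hu : u ∈ Ioo 0 (Real.log 2)) : ContinuousAt bias u := by
  have himg : bias '' Icc 0 (Real.log 2) = Icc 0 1 := by
    refine Subset.antisymm (image_subset_iff.2 fun u hu => bias_mem hu) fun s hs => ?_
    exact ⟨biasEntropy s, biasEntropy_mem hs, bias_biasEntropy hs⟩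
  have hb := bias_mem_Ioo hu
  have h : ContinuousAt (fun u => -bias u) u := by
    refine StrictMonoOn.continuousAt_of_image_mem_nhds (s := Icc 0 (Real.log 2))
      (fun a ha b hb h => neg_lt_neg (bias_strictAntiOn ha hb h)) (Icc_mem_nhds hu.1 hu.2) ?_
    have : (fun u => -bias u) '' Icc 0 (Real.log 2) = Icc (-1) 0 := by
      rw [show (fun u => -bias u) = Neg.neg ∘ bias from rfl, image_comp, himg]
      simp
    rw [this]
    exact Icc_mem_nhds (by linarith [hb.2]) (by linarith [hb.1])
  exact h.neg.congr (Filter.Eventually.of_forall fun x => neg_neg (bias x))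

lemma hasDerivAt_bias {u : ℝ} (hu : u ∈ Ioo 0 (Real.log 2)) :
    HasDerivAt bias (-artanh (bias u))⁻¹ u := by
  have hb := bias_mem_Ioo hu
  refine HasDerivAt.of_local_left_inverse (continuousAt_bias hu)
    (hasDerivAt_biasEntropy ⟨by linarith [hb.1], hb.2⟩) (neg_ne_zero.2 (artanh_pos hb).ne') ?_
  filter_upwards [Ioo_mem_nhds hu.1 hu.2] with x hx
  exact biasEntropy_bias (Ioo_subset_Icc_self hx)

lemma gerber_eq (u v : ℝ) : gerber u v = biasEntropy (bias u * bias v) := by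
  unfold gerber biasEntropy bias binConv
  congr 1
  ring

lemma gerber_comm (u v : ℝ) : gerber u v = gerber v u := by
  rw [gerber_eq, gerber_eq, mul_comm]

lemma gerber_zero_left {v : ℝ} (hv : v ∈ Icc 0 (Real.log 2)) : gerber 0 v = v := by
  rw [gerber_eq, bias_zero, one_mul, biasEntropy_bias hv]

lemma gerber_log_two_left (v : ℝ) : gerber (Real.log 2) v = Real.log 2 := by
  rw [gerber_eq, bias_log_two, zero_mul, biasEntropy_zero]

/-- `h (a ⋆ b)` depends only on `h a` and `h b`, also when `a` or `b` exceeds `1 / 2`. -/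
lemma gerber_binEntropy {a b : ℝ} (ha : a ∈ Icc (0 : ℝ) 1) (hb : b ∈ Icc (0 : ℝ) 1) :
    gerber (binEntropy a) (binEntropy b) = binEntropy (binConv a b) := by
  have habs : ∀ x : ℝ, biasEntropy |x| = biasEntropy x := by
    intro x
    rcases abs_choice x with h | h
    · rw [h]
    · rw [h, biasEntropy, biasEntropy, ← binEntropy_one_sub]
      congr 1
      ring
  have key : ∀ x ∈ Icc (0 : ℝ) 1, bias (binEntropy x) = |1 - 2 * x| := by
    intro x hx
    have : binEntropy x = biasEntropy |1 - 2 * x| := by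
      rw [habs, biasEntropy]
      congr 1
      ring
    rw [this, bias_biasEntropy ⟨abs_nonneg _, ?_⟩]
    rw [abs_le]
    constructor <;> linarith [hx.1, hx.2]
  rw [gerber_eq, key a ha, key b hb, ← abs_mul, habs, biasEntropy, binConv]
  congr 1
  ring

/-- Supporting lines with slopes in `[0, 1]` for `gerber` in its first variable. -/
lemma biasEntropy_support {s₀ t : ℝ} (hs₀ : s₀ ∈ Icc (0 : ℝ) 1) (ht : t ∈ Icc (0 : ℝ) 1) :
    ∃ m ∈ Icc (0 : ℝ) 1, ∀ s ∈ Icc (0 : ℝ) 1,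
      biasEntropy (s₀ * t) + m * (biasEntropy s - biasEntropy s₀) ≤ biasEntropy (s * t) := by
  rcases ht.1.eq_or_lt with rfl | ht0
  · exact ⟨0, ⟨le_rfl, zero_le_one⟩, fun s _ => by simp⟩
  rcases ht.2.eq_or_lt with rfl | ht1
  · exact ⟨1, ⟨zero_le_one, le_rfl⟩, fun s _ => by simp⟩
  rcases hs₀.1.eq_or_lt with rfl | hs0
  · refine ⟨1, ⟨zero_le_one, le_rfl⟩, fun s hs => ?_⟩
    have := biasEntropy_le (mul_nonneg hs.1 ht.1) (mul_le_of_le_one_right hs.1 ht.2) hs.2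
    simpa using this
  rcases hs₀.2.eq_or_lt with rfl | hs1
  · refine ⟨0, ⟨le_rfl, zero_le_one⟩, fun s hs => ?_⟩
    have := biasEntropy_le (mul_nonneg hs.1 ht.1) (mul_le_of_le_one_left ht.1 hs.2) ht.2
    simpa using this
  have hs₀' : s₀ ∈ Ioo (0 : ℝ) 1 := ⟨hs0, hs1⟩
  have ht' : t ∈ Ioo (0 : ℝ) 1 := ⟨ht0, ht1⟩
  have hA := artanh_pos hs₀'
  have hB := artanh_pos (mul_mem_Ioo hs₀' ht')
  set m := t * artanh (s₀ * t) / artanh s₀ with hm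
  have hmA : m * artanh s₀ = t * artanh (s₀ * t) := by rw [hm, div_mul_cancel₀ _ hA.ne']
  refine ⟨m, ⟨by positivity, ?_⟩, fun s hs => ?_⟩
  · rw [hm, div_le_one hA]
    have : artanh (s₀ * t) ≤ artanh s₀ :=
      artanh_le_artanh (by nlinarith) hs1 (mul_le_of_le_one_right hs0.le ht1.le)
    nlinarith
  have hd : ∀ x ∈ Ioo (0 : ℝ) 1, HasDerivAt (fun x => biasEntropy (x * t) - m * biasEntropy x)
      (m * artanh x - t * artanh (x * t)) x := by
    intro x hx
    have hxt := mul_mem_Ioo hx ht'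
    have h1 := HasDerivAt.comp (h₂ := biasEntropy) x
      (hasDerivAt_biasEntropy ⟨by linarith [hxt.1], hxt.2⟩) (hasDerivAt_mul_const t)
    refine (h1.sub ((hasDerivAt_biasEntropy ⟨by linarith [hx.1], hx.2⟩).const_mul m)).congr_deriv ?_
    ring
  have hc : Continuous (fun x => biasEntropy (x * t) - m * biasEntropy x) := by fun_prop
  suffices h : biasEntropy (s₀ * t) - m * biasEntropy s₀ ≤
      biasEntropy (s * t) - m * biasEntropy s by linarith
  rcases le_total s₀ s with hle | hle
  · have hmono : MonotoneOn (fun x => biasEntropy (x * t) - m * biasEntropy x) (Icc s₀ 1) := by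
      refine monotoneOn_of_deriv_nonneg (convex_Icc s₀ 1) hc.continuousOn ?_ ?_ <;>
        rw [interior_Icc]
      · exact fun x hx => (hd x ⟨hs0.trans hx.1, hx.2⟩).differentiableAt.differentiableWithinAt
      · intro x hx
        have hx' : x ∈ Ioo (0 : ℝ) 1 := ⟨hs0.trans hx.1, hx.2⟩
        rw [(hd x hx').deriv, sub_nonneg]
        have := mul_le_mul_of_nonneg_left (artanh_mul_le hs₀' hx' ht' hx.1.le) ht0.le
        refine le_of_mul_le_mul_right ?_ hA
        linear_combination this - artanh x * hmA
    exact hmono ⟨le_rfl, hs1.le⟩ ⟨hle, hs.2⟩ hle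
  · have hanti : AntitoneOn (fun x => biasEntropy (x * t) - m * biasEntropy x) (Icc 0 s₀) := by
      refine antitoneOn_of_deriv_nonpos (convex_Icc 0 s₀) hc.continuousOn ?_ ?_ <;>
        rw [interior_Icc]
      · exact fun x hx => (hd x ⟨hx.1, hx.2.trans hs1⟩).differentiableAt.differentiableWithinAt
      · intro x hx
        have hx' : x ∈ Ioo (0 : ℝ) 1 := ⟨hx.1, hx.2.trans hs1⟩
        rw [(hd x hx').deriv, sub_nonpos]
        have := mul_le_mul_of_nonneg_left (artanh_mul_le hx' hs₀' ht' hx.2.le) ht0.le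
        refine le_of_mul_le_mul_right ?_ hA
        linear_combination this + artanh x * hmA
    exact hanti ⟨hs.1, hle⟩ ⟨hs0.le, le_rfl⟩ hle

lemma gerber_support {u₀ v : ℝ} (hu₀ : u₀ ∈ Icc 0 (Real.log 2)) (hv : v ∈ Icc 0 (Real.log 2)) :
    ∃ m ∈ Icc (0 : ℝ) 1, ∀ u ∈ Icc 0 (Real.log 2), gerber u₀ v + m * (u - u₀) ≤ gerber u v := by
  obtain ⟨m, hm, h⟩ := biasEntropy_support (bias_mem hu₀) (bias_mem hv)
  refine ⟨m, hm, fun u hu => ?_⟩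
  have := h _ (bias_mem hu)
  rwa [biasEntropy_bias hu, biasEntropy_bias hu₀, ← gerber_eq, ← gerber_eq] at this

/-- The derivative of `gerber` at an interior point `(u, v)` in direction `(d, e)`. -/
def gerberDeriv (u v d e : ℝ) : ℝ :=
  phi (bias u * bias v) * (d / phi (bias u) + e / phi (bias v))

lemma hasDerivAt_gerber_line {u v d e x : ℝ} (hu : u + x * d ∈ Ioo 0 (Real.log 2))
    (hv : v + x * e ∈ Ioo 0 (Real.log 2)) :
    HasDerivAt (fun x => gerber (u + x * d) (v + x * e))
      (gerberDeriv (u + x * d) (v + x * e) d e) x := by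
  have hs := bias_mem_Ioo hu
  have ht := bias_mem_Ioo hv
  have hst := mul_mem_Ioo hs ht
  have h1 : HasDerivAt (fun x => bias (u + x * d)) ((-artanh (bias (u + x * d)))⁻¹ * d) x :=
    HasDerivAt.comp (h₂ := bias) x (hasDerivAt_bias hu) ((hasDerivAt_mul_const d).const_add u)
  have h2 : HasDerivAt (fun x => bias (v + x * e)) ((-artanh (bias (v + x * e)))⁻¹ * e) x :=
    HasDerivAt.comp (h₂ := bias) x (hasDerivAt_bias hv) ((hasDerivAt_mul_const e).const_add v)
  have h := HasDerivAt.comp (h₂ := biasEntropy) (h := fun x => bias (u + x * d) * bias (v + x * e))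
    x (hasDerivAt_biasEntropy ⟨by linarith [hst.1], hst.2⟩) (h1.mul h2)
  have hfun : (fun x => gerber (u + x * d) (v + x * e)) =
      fun x => biasEntropy (bias (u + x * d) * bias (v + x * e)) := by
    funext x
    rw [gerber_eq]
  rw [hfun]
  refine h.congr_deriv ?_
  have a1 := (artanh_pos hs).ne'
  have a2 := (artanh_pos ht).ne'
  have b1 := hs.1.ne'
  have b2 := ht.1.ne'
  unfold gerberDeriv phi
  field_simp
  ring

/-- The Hessian of `gerber` is indefinite: at each interior point there is a direction in which its
second derivative is negative. -/
lemma exists_hasDerivAt_gerberDeriv_neg {u v : ℝ} (hu : u ∈ Ioo 0 (Real.log 2))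
    (hv : v ∈ Ioo 0 (Real.log 2)) :
    ∃ d e κ : ℝ, κ < 0 ∧
      HasDerivAt (fun x => gerberDeriv (u + x * d) (v + x * e) d e) κ 0 := by
  have hs := bias_mem_Ioo hu
  have ht := bias_mem_Ioo hv
  have hst := mul_mem_Ioo hs ht
  set s := bias u
  set t := bias v
  have ps := phi_pos hs
  have pt := phi_pos ht
  have pst := phi_pos hst
  have ws := phiElast_pos hs
  have wt := phiElast_pos ht
  have a1 := (artanh_pos hs).ne'
  have a2 := (artanh_pos ht).ne'
  have b1 := hs.1.ne'
  have b2 := ht.1.ne'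
  -- the direction in which the quotient of the two partial derivatives is stationary
  set d := -(phi s / phiElast s) with hd
  set e := -(phi t / phiElast t) with he
  have h1 : HasDerivAt (fun x => bias (u + x * d)) (s / phiElast s) 0 := by
    have h := HasDerivAt.comp (h₂ := bias) (h := fun x => u + x * d) 0
      (hasDerivAt_bias (by simpa using hu)) ((hasDerivAt_mul_const d).const_add u)
    refine h.congr_deriv ?_
    simp only [zero_mul, add_zero]
    change (-artanh s)⁻¹ * d = _
    rw [hd, phi]
    field_simp
  have h2 : HasDerivAt (fun x => bias (v + x * e)) (t / phiElast t) 0 := by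
    have h := HasDerivAt.comp (h₂ := bias) (h := fun x => v + x * e) 0
      (hasDerivAt_bias (by simpa using hv)) ((hasDerivAt_mul_const e).const_add v)
    refine h.congr_deriv ?_
    simp only [zero_mul, add_zero]
    change (-artanh t)⁻¹ * e = _
    rw [he, phi]
    field_simp
  have e1 : bias (u + 0 * d) = s := by simp [s]
  have e2 : bias (v + 0 * e) = t := by simp [t]
  have k1 : HasDerivAt (fun x => phi (bias (u + x * d))) (phi s) 0 := by
    refine (HasDerivAt.comp (h₂ := phi) (h := fun x => bias (u + x * d)) 0
      (hasDerivAt_phi (by rwa [e1])) h1).congr_deriv ?_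
    rw [e1]
    field_simp
  have k2 : HasDerivAt (fun x => phi (bias (v + x * e))) (phi t) 0 := by
    refine (HasDerivAt.comp (h₂ := phi) (h := fun x => bias (v + x * e)) 0
      (hasDerivAt_phi (by rwa [e2])) h2).congr_deriv ?_
    rw [e2]
    field_simp
  have k3 : HasDerivAt (fun x => phi (bias (u + x * d) * bias (v + x * e)))
      (phi (s * t) * (phiElast (s * t) * ((phiElast s)⁻¹ + (phiElast t)⁻¹))) 0 := by
    refine (HasDerivAt.comp (h₂ := phi) (h := fun x => bias (u + x * d) * bias (v + x * e)) 0
      (hasDerivAt_phi (by rwa [e1, e2])) (h1.mul h2)).congr_deriv ?_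
    rw [e1, e2]
    field_simp
  have k4 := k3.mul (((hasDerivAt_const (0 : ℝ) d).div k1 (by rw [e1]; exact ps.ne')).add
    ((hasDerivAt_const (0 : ℝ) e).div k2 (by rw [e2]; exact pt.ne')))
  refine ⟨d, e, _, ?_, k4⟩
  simp only [Pi.add_apply, Pi.div_apply, e1, e2]
  have hg : 0 < (phiElast s)⁻¹ + (phiElast t)⁻¹ := by positivity
  have key := one_lt_phiElast_mul hs ht
  have hval : phi (s * t) * (phiElast (s * t) * ((phiElast s)⁻¹ + (phiElast t)⁻¹)) *
      (d / phi s + e / phi t) + phi (s * t) *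
      ((0 * phi s - d * phi s) / phi s ^ 2 + (0 * phi t - e * phi t) / phi t ^ 2) =
      -(phi (s * t) * ((phiElast s)⁻¹ + (phiElast t)⁻¹) *
        (phiElast (s * t) * ((phiElast s)⁻¹ + (phiElast t)⁻¹) - 1)) := by
    rw [hd, he]
    field_simp
    ring
  rw [hval, neg_lt_zero]
  exact mul_pos (mul_pos pst hg) (by linarith)

/-! ### The explicit lower bound -/

/-- The explicit candidate for the minimal entropy of a sum in a group of order `2 ^ n`. It does
not depend on `n`. -/
def gerberExt (x y : ℝ) : ℝ :=
  if ⌊x / Real.log 2⌋₊ = ⌊y / Real.log 2⌋₊ then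
    gerber (x - ⌊x / Real.log 2⌋₊ * Real.log 2) (y - ⌊x / Real.log 2⌋₊ * Real.log 2) +
      ⌊x / Real.log 2⌋₊ * Real.log 2
  else max x y

lemma gerberExt_comm (x y : ℝ) : gerberExt x y = gerberExt y x := by
  unfold gerberExt
  by_cases h : ⌊x / Real.log 2⌋₊ = ⌊y / Real.log 2⌋₊
  · rw [if_pos h, if_pos h.symm, h, gerber_comm]
  · rw [if_neg h, if_neg (Ne.symm h), max_comm]

lemma floor_mul_log_le {x : ℝ} (hx : 0 ≤ x) : ⌊x / Real.log 2⌋₊ * Real.log 2 ≤ x := by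
  rw [← le_div_iff₀ log_two_pos]
  exact Nat.floor_le (div_nonneg hx log_two_nonneg)

lemma lt_floor_mul_log (x : ℝ) : x < (⌊x / Real.log 2⌋₊ + 1) * Real.log 2 := by
  rw [← div_lt_iff₀ log_two_pos]
  exact Nat.lt_floor_add_one _

lemma mem_logBox_floor {x : ℝ} (hx : 0 ≤ x) : x ∈ logBox ⌊x / Real.log 2⌋₊ :=
  ⟨floor_mul_log_le hx, (lt_floor_mul_log x).le⟩

lemma sub_mem_of_mem_logBox {x : ℝ} {k : ℕ} (hx : x ∈ logBox k) :
    x - k * Real.log 2 ∈ Icc 0 (Real.log 2) := by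
  have h1 : k * Real.log 2 ≤ x := hx.1
  have h2 : x ≤ (k + 1) * Real.log 2 := hx.2
  constructor <;> linarith

lemma nonneg_of_mem_logBox {x : ℝ} {k : ℕ} (hx : x ∈ logBox k) : 0 ≤ x :=
  (mul_nonneg k.cast_nonneg log_two_nonneg).trans hx.1

lemma floor_eq_or {x : ℝ} {k : ℕ} (hx : x ∈ logBox k) :
    ⌊x / Real.log 2⌋₊ = k ∨ ⌊x / Real.log 2⌋₊ = k + 1 ∧ x = (k + 1) * Real.log 2 := by
  have hL := log_two_pos
  rcases hx.2.lt_or_eq with h | h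
  · left
    rw [Nat.floor_eq_iff (div_nonneg (nonneg_of_mem_logBox hx) hL.le)]
    exact ⟨(le_div_iff₀ hL).2 hx.1, (div_lt_iff₀ hL).2 h⟩
  · right
    refine ⟨?_, h⟩
    rw [h, mul_div_assoc, div_self hL.ne', mul_one]
    exact_mod_cast Nat.floor_natCast (R := ℝ) (k + 1)

lemma zero_mem_box : (0 : ℝ) ∈ Icc 0 (Real.log 2) := ⟨le_rfl, log_two_nonneg⟩

lemma log_two_mem_box : Real.log 2 ∈ Icc 0 (Real.log 2) := ⟨log_two_nonneg, le_rfl⟩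

lemma gerberExt_of_mem_logBox {x y : ℝ} {k : ℕ} (hx : x ∈ logBox k) (hy : y ∈ logBox k) :
    gerberExt x y = gerber (x - k * Real.log 2) (y - k * Real.log 2) + k * Real.log 2 := by
  have edge : (k + 1) * Real.log 2 - k * Real.log 2 = Real.log 2 := by ring
  unfold gerberExt
  rcases floor_eq_or hx with h | ⟨h, hx'⟩ <;> rcases floor_eq_or hy with h' | ⟨h', hy'⟩ <;>
    rw [h, h']
  · rw [if_pos rfl]
  · rw [if_neg (by omega), hy', edge, gerber_comm, gerber_log_two_left, max_eq_right hx.2]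
    ring
  · rw [if_neg (by omega), hx', edge, gerber_log_two_left, max_eq_left hy.2]
    ring
  · rw [if_pos rfl, hx', hy', edge, gerber_log_two_left]
    push_cast
    rw [sub_self, gerber_zero_left zero_mem_box]
    ring

lemma gerberExt_of_le_of_le {x y : ℝ} {k : ℕ} (hx0 : 0 ≤ x) (hx : x ≤ k * Real.log 2)
    (hy : k * Real.log 2 ≤ y) : gerberExt x y = y := by
  have hL := log_two_pos
  have hy0 : 0 ≤ y := hx0.trans (hx.trans hy)
  unfold gerberExt
  split_ifs with h
  · have h1 : k ≤ ⌊y / Real.log 2⌋₊ := Nat.le_floor ((le_div_iff₀ hL).2 hy)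
    have h2 := floor_mul_log_le hx0
    have h3 : ⌊x / Real.log 2⌋₊ = k := by
      refine le_antisymm ?_ (h ▸ h1)
      exact_mod_cast le_of_mul_le_mul_right (h2.trans hx) hL
    have h4 := sub_mem_of_mem_logBox (mem_logBox_floor hy0)
    rw [← h, h3] at h4
    rw [h3] at h2
    rw [h3, le_antisymm hx h2, sub_self, gerber_zero_left h4]
    ring
  · exact max_eq_right (hx.trans hy)

lemma gerberExt_of_le_of_le' {x y : ℝ} {k : ℕ} (hy0 : 0 ≤ y) (hy : y ≤ k * Real.log 2)
    (hx : k * Real.log 2 ≤ x) : gerberExt x y = x := by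
  rw [gerberExt_comm, gerberExt_of_le_of_le hy0 hy hx]

lemma gerberExt_unit {u v : ℝ} (hu : u ∈ Icc 0 (Real.log 2)) (hv : v ∈ Icc 0 (Real.log 2)) :
    gerberExt u v = gerber u v := by
  rw [gerberExt_of_mem_logBox (k := 0)] <;> simp_all [logBox]

/-- Two entropies lie in a common box, or a multiple of `log 2` separates them. -/
lemma box_or_separated {x y : ℝ} (hx : 0 ≤ x) (hy : 0 ≤ y) :
    (∃ k : ℕ, x ∈ logBox k ∧ y ∈ logBox k) ∨
      (∃ k : ℕ, x ≤ k * Real.log 2 ∧ k * Real.log 2 ≤ y) ∨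
      ∃ k : ℕ, y ≤ k * Real.log 2 ∧ k * Real.log 2 ≤ x := by
  have key : ∀ a b : ℝ, 0 ≤ a → 0 ≤ b → ⌊a / Real.log 2⌋₊ < ⌊b / Real.log 2⌋₊ →
      ∃ k : ℕ, a ≤ k * Real.log 2 ∧ k * Real.log 2 ≤ b := by
    intro a b ha hb h
    refine ⟨_, (lt_floor_mul_log a).le.trans ?_, floor_mul_log_le hb⟩
    exact mul_le_mul_of_nonneg_right (by exact_mod_cast h) log_two_nonneg
  rcases lt_trichotomy ⌊x / Real.log 2⌋₊ ⌊y / Real.log 2⌋₊ with h | h | h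
  · exact Or.inr (Or.inl (key x y hx hy h))
  · exact Or.inl ⟨_, mem_logBox_floor hx, h ▸ mem_logBox_floor hy⟩
  · exact Or.inr (Or.inr (key y x hy hx h))

lemma le_gerber_right {u v : ℝ} (hu : u ∈ Icc 0 (Real.log 2)) (hv : v ∈ Icc 0 (Real.log 2)) :
    v ≤ gerber u v := by
  have h1 := bias_mem hu
  have h2 := bias_mem hv
  have := biasEntropy_le (mul_nonneg h1.1 h2.1) (mul_le_of_le_one_left h2.1 h1.2) h2.2
  rwa [biasEntropy_bias hv, ← gerber_eq] at this

lemma le_gerberExt_right {x y : ℝ} (hx : 0 ≤ x) (hy : 0 ≤ y) : y ≤ gerberExt x y := by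
  rcases box_or_separated hx hy with ⟨k, h1, h2⟩ | ⟨k, h1, h2⟩ | ⟨k, h1, h2⟩
  · rw [gerberExt_of_mem_logBox h1 h2]
    linarith [le_gerber_right (sub_mem_of_mem_logBox h1) (sub_mem_of_mem_logBox h2)]
  · rw [gerberExt_of_le_of_le hx h1 h2]
  · rw [gerberExt_of_le_of_le' hy h1 h2]
    exact h1.trans h2

lemma le_gerberExt_left {x y : ℝ} (hx : 0 ≤ x) (hy : 0 ≤ y) : x ≤ gerberExt x y :=
  gerberExt_comm y x ▸ le_gerberExt_right hy hx

/-- Supporting lines with slopes in `[0, 1]`: this encodes that `gerberExt` is convex,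
nondecreasing and `1`-Lipschitz in its first variable. -/
lemma gerberExt_support {x₀ y : ℝ} (hx₀ : 0 ≤ x₀) (hy : 0 ≤ y) :
    ∃ m ∈ Icc (0 : ℝ) 1, ∀ x, 0 ≤ x → gerberExt x₀ y + m * (x - x₀) ≤ gerberExt x y := by
  rcases box_or_separated hx₀ hy with ⟨k, h1, h2⟩ | ⟨k, h1, h2⟩ | ⟨k, h1, h2⟩
  · have hv := sub_mem_of_mem_logBox h2
    obtain ⟨m, hm, h⟩ := gerber_support (sub_mem_of_mem_logBox h1) hv
    refine ⟨m, hm, fun x hx => ?_⟩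
    rw [gerberExt_of_mem_logBox h1 h2]
    rcases le_total x (k * Real.log 2) with hk | hk
    · have := h 0 zero_mem_box
      rw [gerber_zero_left hv] at this
      rw [gerberExt_of_le_of_le hx hk h2.1]
      nlinarith [mul_nonneg hm.1 (sub_nonneg.2 hk)]
    rcases le_total x ((k + 1) * Real.log 2) with hk' | hk'
    · have hxk : x ∈ logBox k := ⟨hk, hk'⟩
      have := h _ (sub_mem_of_mem_logBox hxk)
      rw [gerberExt_of_mem_logBox hxk h2]
      linarith
    · have := h _ log_two_mem_box
      rw [gerber_log_two_left] at this
      rw [gerberExt_of_le_of_le' (k := k + 1) hy (by exact_mod_cast h2.2) (by exact_mod_cast hk')]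
      nlinarith [mul_nonneg (sub_nonneg.2 hm.2) (sub_nonneg.2 hk')]
  · refine ⟨0, ⟨le_rfl, zero_le_one⟩, fun x hx => ?_⟩
    rw [gerberExt_of_le_of_le hx₀ h1 h2]
    simpa using le_gerberExt_right hx hy
  · refine ⟨1, ⟨zero_le_one, le_rfl⟩, fun x hx => ?_⟩
    rw [gerberExt_of_le_of_le' hy h1 h2]
    simpa using le_gerberExt_left hx hy

lemma gerberExt_support_right {x y₀ : ℝ} (hx : 0 ≤ x) (hy₀ : 0 ≤ y₀) :
    ∃ m ∈ Icc (0 : ℝ) 1, ∀ y, 0 ≤ y → gerberExt x y₀ + m * (y - y₀) ≤ gerberExt x y := by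
  obtain ⟨m, hm, h⟩ := gerberExt_support hy₀ hx
  exact ⟨m, hm, fun y hy => by rw [gerberExt_comm x, gerberExt_comm x]; exact h y hy⟩

lemma gerberExt_mono_left {x x' y : ℝ} (hx : 0 ≤ x) (hxx : x ≤ x') (hy : 0 ≤ y) :
    gerberExt x y ≤ gerberExt x' y := by
  obtain ⟨m, hm, h⟩ := gerberExt_support hx hy
  have := h x' (hx.trans hxx)
  nlinarith [mul_nonneg hm.1 (sub_nonneg.2 hxx)]

lemma gerberExt_mono_right {x y y' : ℝ} (hx : 0 ≤ x) (hy : 0 ≤ y) (hyy : y ≤ y') :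
    gerberExt x y ≤ gerberExt x y' := by
  rw [gerberExt_comm x, gerberExt_comm x]
  exact gerberExt_mono_left hy hyy hx

lemma gerberExt_add_left_le {x y c : ℝ} (hx : 0 ≤ x) (hy : 0 ≤ y) (hc : 0 ≤ c) :
    gerberExt (x + c) y ≤ gerberExt x y + c := by
  obtain ⟨m, hm, h⟩ := gerberExt_support (add_nonneg hx hc) hy
  have := h x hx
  nlinarith [mul_nonneg (sub_nonneg.2 hm.2) hc]

lemma gerberExt_add_right_le {x y c : ℝ} (hx : 0 ≤ x) (hy : 0 ≤ y) (hc : 0 ≤ c) :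
    gerberExt x (y + c) ≤ gerberExt x y + c := by
  rw [gerberExt_comm x, gerberExt_comm x]
  exact gerberExt_add_left_le hy hx hc

lemma add_mem_logBox {x : ℝ} {k : ℕ} (hx : x ∈ logBox k) (j : ℕ) :
    x + j * Real.log 2 ∈ logBox (k + j) := by
  have h1 : k * Real.log 2 ≤ x := hx.1
  have h2 : x ≤ (k + 1) * Real.log 2 := hx.2
  constructor <;> push_cast <;> linarith

lemma gerberExt_translate {x y : ℝ} (hx : 0 ≤ x) (hy : 0 ≤ y) (j : ℕ) :
    gerberExt (x + j * Real.log 2) (y + j * Real.log 2) = gerberExt x y + j * Real.log 2 := by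
  have hj : 0 ≤ j * Real.log 2 := mul_nonneg j.cast_nonneg log_two_nonneg
  rcases box_or_separated hx hy with ⟨k, h1, h2⟩ | ⟨k, h1, h2⟩ | ⟨k, h1, h2⟩
  · rw [gerberExt_of_mem_logBox h1 h2,
      gerberExt_of_mem_logBox (add_mem_logBox h1 j) (add_mem_logBox h2 j)]
    push_cast
    rw [show x + j * Real.log 2 - (k + j) * Real.log 2 = x - k * Real.log 2 by ring,
      show y + j * Real.log 2 - (k + j) * Real.log 2 = y - k * Real.log 2 by ring]
    ring
  · rw [gerberExt_of_le_of_le hx h1 h2, gerberExt_of_le_of_le (k := k + j) (add_nonneg hx hj)] <;>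
      push_cast <;> linarith
  · rw [gerberExt_of_le_of_le' hy h1 h2, gerberExt_of_le_of_le' (k := k + j) (add_nonneg hy hj)] <;>
      push_cast <;> linarith

lemma continuousOn_gerberExt :
    ContinuousOn (fun z : ℝ × ℝ => gerberExt z.1 z.2) (Ici 0 ×ˢ Ici 0) := by
  have h1 : ∀ x x' y : ℝ, 0 ≤ x → 0 ≤ x' → 0 ≤ y →
      |gerberExt x y - gerberExt x' y| ≤ |x - x'| := by
    intro x x' y hx hx' hy
    wlog hle : x ≤ x' generalizing x x'
    · rw [abs_sub_comm, abs_sub_comm x]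
      exact this x' x hx' hx (le_of_not_ge hle)
    have a1 := gerberExt_mono_left hx hle hy
    have a2 := gerberExt_add_left_le hx hy (sub_nonneg.2 hle)
    rw [add_sub_cancel] at a2
    rw [abs_sub_comm, abs_sub_comm x, abs_of_nonneg (sub_nonneg.2 a1),
      abs_of_nonneg (sub_nonneg.2 hle)]
    linarith
  refine (LipschitzOnWith.of_dist_le_mul (K := 2) ?_).continuousOn
  rintro ⟨x, y⟩ ⟨hx, hy⟩ ⟨x', y'⟩ ⟨hx', hy'⟩
  have b1 := h1 x x' y hx hx' hy
  have b2 := h1 y y' x' hy hy' hx'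
  rw [gerberExt_comm y, gerberExt_comm y'] at b2
  have b3 := abs_sub_le (gerberExt x y) (gerberExt x' y) (gerberExt x' y')
  have c1 : |x - x'| ≤ dist (x, y) (x', y') := le_max_left (dist x x') (dist y y')
  have c2 : |y - y'| ≤ dist (x, y) (x', y') := le_max_right (dist x x') (dist y y')
  simp only [Real.dist_eq] at *
  push_cast
  linarith

/-! ### Subadditivity -/

lemma gerberExt_add_le_of_edge {u v a b : ℝ} (hu : u = 0 ∨ u = Real.log 2)
    (hv : v ∈ Icc 0 (Real.log 2)) (ha : 0 ≤ a) (hb : 0 ≤ b) :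
    gerberExt (u + a) (v + b) ≤ gerberExt u v + gerberExt a b := by
  rcases hu with rfl | rfl
  · rw [gerberExt_unit zero_mem_box hv, gerber_zero_left hv, zero_add, add_comm v b, add_comm v]
    exact gerberExt_add_right_le ha hb hv.1
  · rw [gerberExt_unit log_two_mem_box hv, gerber_log_two_left]
    have h1 := gerberExt_mono_right (add_nonneg log_two_nonneg ha) (add_nonneg hv.1 hb)
      (add_le_add_left hv.2 b)
    have h2 := gerberExt_translate ha hb 1
    rw [Nat.cast_one, one_mul, add_comm a, add_comm b] at h2
    linarith

/-- A function with derivative `K x - K (-x)` has no local minimum at `0` if `K' 0 < 0`. -/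
lemma not_isLocalMin_of_hasDerivAt {g K : ℝ → ℝ} {κ : ℝ} (hκ : κ < 0) (hK : HasDerivAt K κ 0)
    (hg : ∀ᶠ x in nhds 0, HasDerivAt g (K x - K (-x)) x) : ¬ IsLocalMin g 0 := by
  intro hmin
  have hK' : HasDerivAt (fun x => K x - K (-x)) (κ + κ) 0 := by
    have h := HasDerivAt.comp (h₂ := K) (h := fun x : ℝ => -x) 0 (by simpa using hK)
      (hasDerivAt_neg 0)
    refine (hK.sub h).congr_deriv ?_
    ring
  have hslope := (hasDerivAt_iff_tendsto_slope.1 hK').eventually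
    (Iio_mem_nhds (show κ + κ < 0 by linarith))
  rw [eventually_nhdsWithin_iff] at hslope
  obtain ⟨δ, hδ, h⟩ := Metric.eventually_nhds_iff.1 ((hslope.and hg).and hmin)
  have hin : ∀ x ∈ Icc 0 (δ / 2), dist x 0 < δ := by
    intro x hx
    rw [Real.dist_eq, sub_zero, abs_of_nonneg hx.1]
    linarith [hx.2]
  have hanti : StrictAntiOn g (Icc 0 (δ / 2)) := by
    refine strictAntiOn_of_deriv_neg (convex_Icc _ _)
      (fun x hx => (h (hin x hx)).1.2.continuousAt.continuousWithinAt) fun x hx => ?_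
    rw [interior_Icc] at hx
    obtain ⟨⟨h1, h2⟩, -⟩ := h (hin x (Ioo_subset_Icc_self hx))
    rw [h2.deriv]
    have h3 : slope (fun x => K x - K (-x)) 0 x < 0 := h1 hx.1.ne'
    rw [slope_def_field] at h3
    simp only [neg_zero, sub_self, sub_zero] at h3
    by_contra! hle
    exact absurd h3 (not_lt.2 (div_nonneg hle hx.1.le))
  have hlt := hanti ⟨le_rfl, by linarith⟩ ⟨by linarith, le_rfl⟩ (by linarith : (0 : ℝ) < δ / 2)
  exact absurd (h (hin (δ / 2) ⟨by linarith, le_rfl⟩)).2 (not_le.2 hlt)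

/-- No interior splitting of `(u + a, v + b)` is a local minimum of the sum: stationarity makes the
gradients at `(u, v)` and `(a, b)` equal, hence the points coincide, and there the Hessian is
indefinite. -/
lemma not_forall_isLocalMin {u v a b : ℝ} (hu : u ∈ Ioo 0 (Real.log 2))
    (hv : v ∈ Ioo 0 (Real.log 2)) (ha : a ∈ Ioo 0 (Real.log 2)) (hb : b ∈ Ioo 0 (Real.log 2)) :
    ¬ ∀ d e : ℝ, IsLocalMin
      (fun x => gerber (u + x * d) (v + x * e) + gerber (a + x * -d) (b + x * -e)) 0 := by
  intro hmin
  have hnear : ∀ {w : ℝ} (_ : w ∈ Ioo 0 (Real.log 2)) (d : ℝ),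
      ∀ᶠ x in nhds (0 : ℝ), w + x * d ∈ Ioo 0 (Real.log 2) := by
    intro w hw d
    have hc : Continuous fun x : ℝ => w + x * d := by fun_prop
    exact hc.continuousAt (Ioo_mem_nhds (by simpa using hw.1) (by simpa using hw.2))
  have hderiv : ∀ d e : ℝ, ∀ᶠ x in nhds (0 : ℝ), HasDerivAt
      (fun x => gerber (u + x * d) (v + x * e) + gerber (a + x * -d) (b + x * -e))
      (gerberDeriv (u + x * d) (v + x * e) d e +
        gerberDeriv (a + x * -d) (b + x * -e) (-d) (-e)) x := by
    intro d e
    filter_upwards [hnear hu d, hnear hv e, hnear ha (-d), hnear hb (-e)] with x h1 h2 h3 h4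
    exact (hasDerivAt_gerber_line h1 h2).add (hasDerivAt_gerber_line h3 h4)
  have hstat : ∀ d e : ℝ, gerberDeriv u v d e + gerberDeriv a b (-d) (-e) = 0 := by
    intro d e
    simpa using (hmin d e).hasDerivAt_eq_zero (hderiv d e).self_of_nhds
  obtain ⟨e1, e2⟩ := gradient_injective (bias_mem_Ioo hu) (bias_mem_Ioo hv) (bias_mem_Ioo ha)
    (bias_mem_Ioo hb)
    (by have h := hstat 1 0; simp only [gerberDeriv] at h; linear_combination h)
    (by have h := hstat 0 1; simp only [gerberDeriv] at h; linear_combination h)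
  obtain rfl := bias_injOn (Ioo_subset_Icc_self hu) (Ioo_subset_Icc_self ha) e1
  obtain rfl := bias_injOn (Ioo_subset_Icc_self hv) (Ioo_subset_Icc_self hb) e2
  obtain ⟨d, e, κ, hκ, hK⟩ := exists_hasDerivAt_gerberDeriv_neg hu hv
  refine not_isLocalMin_of_hasDerivAt hκ hK ?_ (hmin d e)
  filter_upwards [hderiv d e] with x hx
  refine hx.congr_deriv ?_
  simp only [gerberDeriv, mul_neg, neg_mul, neg_div]
  ring

lemma gerberExt_add_le_of_unit {u v a b : ℝ} (hu : u ∈ Icc 0 (Real.log 2))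
    (hv : v ∈ Icc 0 (Real.log 2)) (ha : a ∈ Icc 0 (Real.log 2)) (hb : b ∈ Icc 0 (Real.log 2)) :
    gerberExt (u + a) (v + b) ≤ gerberExt u v + gerberExt a b := by
  set x := u + a with hx
  set y := v + b with hy
  set R : Set (ℝ × ℝ) := (Icc 0 (Real.log 2) ×ˢ Icc 0 (Real.log 2)) ∩
    {z | x - z.1 ∈ Icc 0 (Real.log 2) ∧ y - z.2 ∈ Icc 0 (Real.log 2)} with hR
  have hcpt : IsCompact R := by
    refine (isCompact_Icc.prod isCompact_Icc).inter_right ?_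
    exact (isClosed_Icc.preimage (by fun_prop : Continuous fun z : ℝ × ℝ => x - z.1)).inter
      (isClosed_Icc.preimage (by fun_prop : Continuous fun z : ℝ × ℝ => y - z.2))
  have hmem : (u, v) ∈ R := by
    refine ⟨⟨hu, hv⟩, ?_, ?_⟩
    · rwa [hx, add_sub_cancel_left]
    · rwa [hy, add_sub_cancel_left]
  have hcont : ContinuousOn
      (fun z : ℝ × ℝ => gerberExt z.1 z.2 + gerberExt (x - z.1) (y - z.2)) R := by
    refine (continuousOn_gerberExt.mono fun z hz => ⟨hz.1.1.1, hz.1.2.1⟩).add ?_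
    exact continuousOn_gerberExt.comp (f := fun z : ℝ × ℝ => (x - z.1, y - z.2))
      (by fun_prop) fun z hz => ⟨hz.2.1.1, hz.2.2.1⟩
  obtain ⟨⟨p, q⟩, ⟨⟨hp, hq⟩, hp', hq'⟩, hmin⟩ := hcpt.exists_isMinOn ⟨_, hmem⟩ hcont
  simp only at hp hq hp' hq'
  have hle := hmin hmem
  simp only [mem_ofPred_eq] at hle
  rw [show x - u = a by rw [hx]; ring, show y - v = b by rw [hy]; ring] at hle
  refine le_trans ?_ hle
  by_cases hpe : p = 0 ∨ p = Real.log 2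
  · have := gerberExt_add_le_of_edge hpe hq hp'.1 hq'.1
    rwa [add_sub_cancel, add_sub_cancel] at this
  by_cases hpe' : x - p = 0 ∨ x - p = Real.log 2
  · have := gerberExt_add_le_of_edge hpe' hq' hp.1 hq.1
    rwa [sub_add_cancel, sub_add_cancel, add_comm (gerberExt _ _)] at this
  by_cases hqe : q = 0 ∨ q = Real.log 2
  · have := gerberExt_add_le_of_edge hqe hp hq'.1 hp'.1
    rwa [add_sub_cancel, add_sub_cancel, gerberExt_comm y, gerberExt_comm q,
      gerberExt_comm (y - q)] at this
  by_cases hqe' : y - q = 0 ∨ y - q = Real.log 2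
  · have := gerberExt_add_le_of_edge hqe' hp' hq.1 hp.1
    rwa [sub_add_cancel, sub_add_cancel, add_comm (gerberExt _ _), gerberExt_comm y,
      gerberExt_comm q, gerberExt_comm (y - q)] at this
  exfalso
  have hint : ∀ {w : ℝ}, w ∈ Icc 0 (Real.log 2) → ¬ (w = 0 ∨ w = Real.log 2) →
      w ∈ Ioo 0 (Real.log 2) := fun {w} hw hne =>
    ⟨lt_of_le_of_ne hw.1 fun h => hne (Or.inl h.symm),
      lt_of_le_of_ne hw.2 fun h => hne (Or.inr h)⟩
  have hp := hint hp hpe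
  have hq := hint hq hqe
  have hp' := hint hp' hpe'
  have hq' := hint hq' hqe'
  refine not_forall_isLocalMin hp hq hp' hq' fun d e => ?_
  have hnear : ∀ {w : ℝ} (_ : w ∈ Ioo 0 (Real.log 2)) (d : ℝ),
      ∀ᶠ x in nhds (0 : ℝ), w + x * d ∈ Icc 0 (Real.log 2) := by
    intro w hw d
    have hc : Continuous fun x : ℝ => w + x * d := by fun_prop
    exact hc.continuousAt (Icc_mem_nhds (by simpa using hw.1) (by simpa using hw.2))
  filter_upwards [hnear hp d, hnear hq e, hnear hp' (-d), hnear hq' (-e)] with z h1 h2 h3 h4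
  have hz : (p + z * d, q + z * e) ∈ R := by
    refine ⟨⟨h1, h2⟩, ?_, ?_⟩
    · convert h3 using 1
      ring
    · convert h4 using 1
      ring
  have := hmin hz
  simp only [mem_ofPred_eq] at this
  rw [show x - (p + z * d) = x - p + z * -d by ring,
    show y - (q + z * e) = y - q + z * -e by ring, gerberExt_unit h1 h2, gerberExt_unit h3 h4,
    gerberExt_unit (Ioo_subset_Icc_self hp) (Ioo_subset_Icc_self hq),
    gerberExt_unit (Ioo_subset_Icc_self hp') (Ioo_subset_Icc_self hq')] at this
  simpa using this

/-- The inequality that drives the induction over the order of the group: `(u, v)` are the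
entropies in a quotient of order `2`, and `(a, b)` the conditional entropies in its kernel. -/
theorem gerberExt_add_le {u v a b : ℝ} (hu : u ∈ Icc 0 (Real.log 2))
    (hv : v ∈ Icc 0 (Real.log 2)) (ha : 0 ≤ a) (hb : 0 ≤ b) :
    gerberExt (u + a) (v + b) ≤ gerber u v + gerberExt a b := by
  rw [← gerberExt_unit hu hv]
  have sep : ∀ {u v a b : ℝ} {k : ℕ}, u ∈ Icc 0 (Real.log 2) → v ∈ Icc 0 (Real.log 2) →
      0 ≤ a → 0 ≤ b → a ≤ k * Real.log 2 → k * Real.log 2 ≤ b →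
      gerberExt (u + a) (v + b) ≤ gerberExt u v + gerberExt a b := by
    intro u v a b k hu hv ha hb h1 h2
    have hb' : 0 ≤ b - k * Real.log 2 := by linarith
    have e1 := gerberExt_mono_left (add_nonneg hu.1 ha) (add_le_add_right h1 u)
      (add_nonneg hv.1 hb)
    have e2 := gerberExt_translate hu.1 (add_nonneg hv.1 hb') k
    rw [show v + (b - k * Real.log 2) + k * Real.log 2 = v + b by ring] at e2
    have e3 := gerberExt_add_right_le hu.1 hv.1 hb'
    rw [gerberExt_of_le_of_le ha h1 h2]
    linarith
  rcases box_or_separated ha hb with ⟨k, h1, h2⟩ | ⟨k, h1, h2⟩ | ⟨k, h1, h2⟩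
  · have h1' := sub_mem_of_mem_logBox h1
    have h2' := sub_mem_of_mem_logBox h2
    have h := gerberExt_add_le_of_unit hu hv h1' h2'
    have e1 := gerberExt_translate h1'.1 h2'.1 k
    have e2 := gerberExt_translate (add_nonneg hu.1 h1'.1) (add_nonneg hv.1 h2'.1) k
    rw [sub_add_cancel, sub_add_cancel] at e1
    rw [add_assoc, sub_add_cancel, add_assoc, sub_add_cancel] at e2
    linarith
  · exact sep hu hv ha hb h1 h2
  · have := sep hv hu hb ha h1 h2
    rwa [gerberExt_comm, gerberExt_comm v, gerberExt_comm b] at this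

/-! ### Entropy of finite distributions -/

section Entropy

variable {ι : Type*} [Fintype ι]

/-- Shannon entropy of a function on a finite type. -/
def entropy (p : ι → ℝ) : ℝ := ∑ i, negMulLog (p i)

/-- The entropy of a nonnegative function `p` of total mass `m`, normalized so as to be homogeneous:
it equals `m` times the entropy of the probability distribution `p / m`. -/
def massEntropy (p : ι → ℝ) : ℝ := entropy p - negMulLog (∑ i, p i)

/-- `p` is a probability distribution. -/
def IsDistr (p : ι → ℝ) : Prop := (∀ i, 0 ≤ p i) ∧ ∑ i, p i = 1

lemma IsDistr.le_one {p : ι → ℝ} (hp : IsDistr p) (i : ι) : p i ≤ 1 :=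
  hp.2 ▸ Finset.single_le_sum (fun j _ => hp.1 j) (Finset.mem_univ i)

lemma entropy_nonneg {p : ι → ℝ} (hp : IsDistr p) : 0 ≤ entropy p :=
  Finset.sum_nonneg fun i _ => negMulLog_nonneg (hp.1 i) (hp.le_one i)

lemma entropy_le_log_card [Nonempty ι] {p : ι → ℝ} (hp : IsDistr p) :
    entropy p ≤ Real.log (Fintype.card ι) := by
  have hN : (0 : ℝ) < Fintype.card ι := by exact_mod_cast Fintype.card_pos
  have h := concaveOn_negMulLog.le_map_sum (t := Finset.univ)
    (w := fun _ : ι => (Fintype.card ι : ℝ)⁻¹) (p := p) (fun _ _ => by positivity)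
    (by simp [hN.ne']) (fun i _ => hp.1 i)
  simp only [smul_eq_mul, ← Finset.mul_sum] at h
  rw [hp.2, mul_one, negMulLog, Real.log_inv] at h
  have h' := mul_le_mul_of_nonneg_left h hN.le
  rw [← mul_assoc, mul_inv_cancel₀ hN.ne', one_mul] at h'
  refine h'.trans_eq ?_
  field_simp

lemma massEntropy_const_mul {p : ι → ℝ} (hp : ∑ i, p i = 1) (c : ℝ) :
    massEntropy (fun i => c * p i) = c * entropy p := by
  simp only [massEntropy, entropy, negMulLog_mul, Finset.sum_add_distrib, ← Finset.sum_mul,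
    ← Finset.mul_sum, hp, mul_one, one_mul]
  ring

lemma massEntropy_of_sum_eq_zero {p : ι → ℝ} (hp : ∀ i, 0 ≤ p i) (h : ∑ i, p i = 0) :
    massEntropy p = 0 := by
  have h0 : ∀ i, p i = 0 := fun i =>
    (Finset.sum_eq_zero_iff_of_nonneg fun i _ => hp i).1 h i (Finset.mem_univ i)
  simp [massEntropy, entropy, h0]

lemma exists_eq_mul_distr {p : ι → ℝ} (hp : ∀ i, 0 ≤ p i) (h : ∑ i, p i ≠ 0) :
    ∃ p' : ι → ℝ, IsDistr p' ∧ p = fun i => (∑ i, p i) * p' i := by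
  refine ⟨fun i => p i / ∑ i, p i,
    ⟨fun i => div_nonneg (hp i) (Finset.sum_nonneg fun i _ => hp i), ?_⟩, ?_⟩
  · rw [← Finset.sum_div, div_self h]
  · funext i
    rw [mul_div_cancel₀ _ h]

lemma massEntropy_nonneg {p : ι → ℝ} (hp : ∀ i, 0 ≤ p i) : 0 ≤ massEntropy p := by
  by_cases h : ∑ i, p i = 0
  · rw [massEntropy_of_sum_eq_zero hp h]
  · obtain ⟨p', hp', e⟩ := exists_eq_mul_distr hp h
    rw [e, massEntropy_const_mul hp'.2]
    exact mul_nonneg (Finset.sum_nonneg fun i _ => hp i) (entropy_nonneg hp')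

/-- Conditioning does not increase entropy. -/
lemma massEntropy_add_le {p q : ι → ℝ} (hp : ∀ i, 0 ≤ p i) (hq : ∀ i, 0 ≤ q i) :
    massEntropy p + massEntropy q ≤ massEntropy (fun i => p i + q i) := by
  by_cases h : ∑ i, p i = 0
  · have h0 : ∀ i, p i = 0 := fun i =>
      (Finset.sum_eq_zero_iff_of_nonneg fun i _ => hp i).1 h i (Finset.mem_univ i)
    simp [massEntropy_of_sum_eq_zero hp h, h0]
  by_cases h' : ∑ i, q i = 0
  · have h0 : ∀ i, q i = 0 := fun i =>
      (Finset.sum_eq_zero_iff_of_nonneg fun i _ => hq i).1 h' i (Finset.mem_univ i)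
    simp [massEntropy_of_sum_eq_zero hq h', h0]
  obtain ⟨p', hp', e⟩ := exists_eq_mul_distr hp h
  obtain ⟨q', hq', e'⟩ := exists_eq_mul_distr hq h'
  have hP : 0 < ∑ i, p i := lt_of_le_of_ne (Finset.sum_nonneg fun i _ => hp i) (Ne.symm h)
  have hQ : 0 < ∑ i, q i := lt_of_le_of_ne (Finset.sum_nonneg fun i _ => hq i) (Ne.symm h')
  set P := ∑ i, p i
  set Q := ∑ i, q i
  have hR : P + Q ≠ 0 := by positivity
  have hmix : (fun i => p i + q i) =
      fun i => (P + Q) * (P / (P + Q) * p' i + Q / (P + Q) * q' i) := by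
    funext i
    rw [congrFun e i, congrFun e' i]
    field_simp
  rw [hmix, massEntropy_const_mul, e, e', massEntropy_const_mul hp'.2, massEntropy_const_mul hq'.2]
  · have hj : P / (P + Q) * entropy p' + Q / (P + Q) * entropy q' ≤
        entropy (fun i => P / (P + Q) * p' i + Q / (P + Q) * q' i) := by
      simp only [entropy, Finset.mul_sum, ← Finset.sum_add_distrib]
      refine Finset.sum_le_sum fun i _ => ?_
      have := concaveOn_negMulLog.2 (hp'.1 i) (hq'.1 i)
        (show 0 ≤ P / (P + Q) by positivity) (show 0 ≤ Q / (P + Q) by positivity) (by field_simp)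
      simpa using this
    have := mul_le_mul_of_nonneg_left hj (by positivity : 0 ≤ P + Q)
    refine le_trans (le_of_eq ?_) this
    field_simp
  · rw [Finset.sum_add_distrib, ← Finset.mul_sum, ← Finset.mul_sum, hp'.2, hq'.2]
    field_simp

lemma entropy_comp_equiv {κ : Type*} [Fintype κ] (e : κ ≃ ι) (p : ι → ℝ) :
    entropy (fun k => p (e k)) = entropy p :=
  Equiv.sum_comp e fun i => negMulLog (p i)

lemma massEntropy_comp_equiv {κ : Type*} [Fintype κ] (e : κ ≃ ι) (p : ι → ℝ) :
    massEntropy (fun k => p (e k)) = massEntropy p := by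
  rw [massEntropy, entropy_comp_equiv, Equiv.sum_comp e p, massEntropy]

end Entropy

/-! ### Convolution -/

section Conv

variable {G : Type*} [AddCommGroup G] [Fintype G]

/-- Convolution of functions on a finite group: the law of a sum of independent variables. -/
def conv (p q : G → ℝ) (g : G) : ℝ := ∑ a, p a * q (g - a)

lemma conv_nonneg {p q : G → ℝ} (hp : ∀ g, 0 ≤ p g) (hq : ∀ g, 0 ≤ q g) (g : G) :
    0 ≤ conv p q g :=
  Finset.sum_nonneg fun a _ => mul_nonneg (hp a) (hq _)

lemma sum_conv (p q : G → ℝ) : ∑ g, conv p q g = (∑ g, p g) * ∑ g, q g := by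
  unfold conv
  rw [Finset.sum_comm, Finset.sum_mul]
  refine Finset.sum_congr rfl fun a _ => ?_
  rw [← Finset.mul_sum]
  congr 1
  exact Equiv.sum_comp (Equiv.subRight a) q

lemma IsDistr.conv {p q : G → ℝ} (hp : IsDistr p) (hq : IsDistr q) : IsDistr (conv p q) :=
  ⟨conv_nonneg hp.1 hq.1, by rw [sum_conv, hp.2, hq.2, one_mul]⟩

lemma conv_comm (p q : G → ℝ) : conv p q = conv q p := by
  funext g
  unfold MrsGerber.conv
  rw [← Equiv.sum_comp (Equiv.subLeft g)]
  simp [mul_comm]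

lemma conv_mul_mul (p q : G → ℝ) (c d : ℝ) :
    conv (fun g => c * p g) (fun g => d * q g) = fun g => c * d * conv p q g := by
  funext g
  simp only [MrsGerber.conv, Finset.mul_sum]
  exact Finset.sum_congr rfl fun a _ => by ring

/-- The claimed lower bound for entropies of convolutions in the group `G`. -/
def EntropyBound (G : Type*) [AddCommGroup G] [Fintype G] : Prop :=
  ∀ p q : G → ℝ, IsDistr p → IsDistr q → gerberExt (entropy p) (entropy q) ≤ entropy (conv p q)

/-- The homogeneous form of `EntropyBound`. If a mass vanishes then both sides are `0`, whatever the
value of the quotients. -/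
lemma EntropyBound.massEntropy_conv (hG : EntropyBound G) {p q : G → ℝ} (hp : ∀ g, 0 ≤ p g)
    (hq : ∀ g, 0 ≤ q g) :
    (∑ g, p g) * (∑ g, q g) *
      gerberExt (massEntropy p / ∑ g, p g) (massEntropy q / ∑ g, q g) ≤
        massEntropy (conv p q) := by
  by_cases h : (∑ g, p g) * (∑ g, q g) = 0
  · rw [massEntropy_of_sum_eq_zero (conv_nonneg hp hq) (by rw [sum_conv, h]), h, zero_mul]
  obtain ⟨h1, h2⟩ := mul_ne_zero_iff.1 h
  obtain ⟨p', hp', e⟩ := exists_eq_mul_distr hp h1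
  obtain ⟨q', hq', e'⟩ := exists_eq_mul_distr hq h2
  have hP : 0 ≤ ∑ g, p g := Finset.sum_nonneg fun i _ => hp i
  have hQ : 0 ≤ ∑ g, q g := Finset.sum_nonneg fun i _ => hq i
  have a1 : massEntropy p / ∑ g, p g = entropy p' := by
    conv_lhs => rw [e, massEntropy_const_mul hp'.2]
    rw [← Finset.mul_sum, hp'.2, mul_one, mul_div_cancel_left₀ _ h1]
  have a2 : massEntropy q / ∑ g, q g = entropy q' := by
    conv_lhs => rw [e', massEntropy_const_mul hq'.2]
    rw [← Finset.mul_sum, hq'.2, mul_one, mul_div_cancel_left₀ _ h2]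
  have a3 : massEntropy (conv p q) = (∑ g, p g) * (∑ g, q g) * entropy (conv p' q') := by
    conv_lhs => rw [e, e', conv_mul_mul]
    exact massEntropy_const_mul (hp'.conv hq').2 _
  rw [a1, a2, a3]
  exact mul_le_mul_of_nonneg_left (hG _ _ hp' hq') (mul_nonneg hP hQ)

/-- Jensen's inequality for `gerberExt` in both variables. -/
lemma gerberExt_jensen {P₀ P₁ Q₀ Q₁ x₀ x₁ y₀ y₁ : ℝ} (hP₀ : 0 ≤ P₀) (hP₁ : 0 ≤ P₁)
    (hP : P₀ + P₁ = 1) (hQ₀ : 0 ≤ Q₀) (hQ₁ : 0 ≤ Q₁) (hQ : Q₀ + Q₁ = 1) (hx₀ : 0 ≤ x₀)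
    (hx₁ : 0 ≤ x₁) (hy₀ : 0 ≤ y₀) (hy₁ : 0 ≤ y₁) :
    gerberExt (P₀ * x₀ + P₁ * x₁) (Q₀ * y₀ + Q₁ * y₁) ≤
      (P₀ * Q₀ * gerberExt x₀ y₀ + P₁ * Q₁ * gerberExt x₁ y₁) +
      (P₀ * Q₁ * gerberExt x₀ y₁ + P₁ * Q₀ * gerberExt x₁ y₀) := by
  have hx : 0 ≤ P₀ * x₀ + P₁ * x₁ := by positivity
  have hy : 0 ≤ Q₀ * y₀ + Q₁ * y₁ := by positivity
  obtain ⟨m, -, hm⟩ := gerberExt_support hx hy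
  have key : ∀ z, 0 ≤ z → gerberExt z (Q₀ * y₀ + Q₁ * y₁) ≤
      Q₀ * gerberExt z y₀ + Q₁ * gerberExt z y₁ := by
    intro z hz
    obtain ⟨m', -, hm'⟩ := gerberExt_support_right hz hy
    have b0 := mul_le_mul_of_nonneg_left (hm' _ hy₀) hQ₀
    have b1 := mul_le_mul_of_nonneg_left (hm' _ hy₁) hQ₁
    obtain rfl : Q₁ = 1 - Q₀ := by linarith
    linarith
  have c0 := mul_le_mul_of_nonneg_left ((hm _ hx₀).trans (key _ hx₀)) hP₀
  have c1 := mul_le_mul_of_nonneg_left ((hm _ hx₁).trans (key _ hx₁)) hP₁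
  obtain rfl : P₁ = 1 - P₀ := by linarith
  linarith

lemma sum_eq_sum_add_sum_coset {K : AddSubgroup G} [Fintype K] {e : G}
    (he : ∀ b, Xor (b + e ∈ K) (b ∈ K)) (f : G → ℝ) :
    ∑ g, f g = ∑ k : K, f k + ∑ k : K, f (k + e) := by
  classical
  rw [← Fintype.sum_subtype_add_sum_subtype (fun g => g ∈ K) f]
  congr 1
  · congr!
  have hmem : ∀ {g}, g ∉ K → g - e ∈ K := by
    intro g hg
    have := he (g - e)
    rw [sub_add_cancel] at this
    exact this.or.resolve_left hg
  refine (Fintype.sum_equiv ⟨fun k : K => (⟨k + e, fun h => ?_⟩ : {g // g ∉ K}),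
    fun g => ⟨g - e, hmem g.2⟩, fun k => ?_, fun g => ?_⟩ _ _ fun k => rfl).symm
  · rcases he k with h' | h'
    · exact h'.2 k.2
    · exact h'.2 h
  · simp
  · simp

/-- The chain rule for the entropy with respect to a subgroup of index `2`. -/
lemma entropy_eq_of_index_two {K : AddSubgroup G} [Fintype K] {e : G}
    (he : ∀ b, Xor (b + e ∈ K) (b ∈ K)) {p : G → ℝ} (hp : ∑ g, p g = 1) :
    entropy p = binEntropy (∑ k : K, p (k + e)) +
      (massEntropy (fun k : K => p k) + massEntropy (fun k : K => p (k + e))) := by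
  rw [sum_eq_sum_add_sum_coset he] at hp
  rw [entropy, sum_eq_sum_add_sum_coset he, binEntropy_eq_negMulLog_add_negMulLog_one_sub,
    ← hp, add_sub_cancel_right]
  simp only [massEntropy, entropy]
  ring

/-- The induction step: the bound passes from a subgroup of index `2` to the group. -/
lemma EntropyBound.of_index_two {K : AddSubgroup G} [Fintype K] (hK : EntropyBound K)
    (hi : K.index = 2) : EntropyBound G := by
  obtain ⟨e, he⟩ := AddSubgroup.index_eq_two_iff.1 hi
  intro p q hp hq
  have hee : e + e ∈ K := by
    rcases he e with h | h
    · exact h.1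
    · exfalso
      have := he 0
      rw [zero_add] at this
      rcases this with h' | h'
      · exact h'.2 K.zero_mem
      · exact h'.2 h.1
  set p₀ : K → ℝ := fun k => p k with hp₀
  set p₁ : K → ℝ := fun k => p (k + e) with hp₁
  set q₀ : K → ℝ := fun k => q k with hq₀
  set q₁ : K → ℝ := fun k => q (k + e) with hq₁
  have np₀ : ∀ k, 0 ≤ p₀ k := fun k => hp.1 _
  have np₁ : ∀ k, 0 ≤ p₁ k := fun k => hp.1 _
  have nq₀ : ∀ k, 0 ≤ q₀ k := fun k => hq.1 _
  have nq₁ : ∀ k, 0 ≤ q₁ k := fun k => hq.1 _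
  have r₀ : (fun k : K => conv p q k) =
      fun k => conv p₀ q₀ k + conv p₁ q₁ (k - ⟨e + e, hee⟩) := by
    funext k
    simp only [MrsGerber.conv]
    rw [sum_eq_sum_add_sum_coset he]
    simp only [hp₀, hp₁, hq₀, hq₁, AddSubgroup.coe_sub]
    congr 1
    refine Finset.sum_congr rfl fun a _ => ?_
    congr 2
    abel
  have r₁ : (fun k : K => conv p q (k + e)) = fun k => conv p₀ q₁ k + conv p₁ q₀ k := by
    funext k
    simp only [MrsGerber.conv]
    rw [sum_eq_sum_add_sum_coset he]
    simp only [hp₀, hp₁, hq₀, hq₁, AddSubgroup.coe_sub]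
    congr 1
    · refine Finset.sum_congr rfl fun a _ => ?_
      congr 2
      abel
    · refine Finset.sum_congr rfl fun a _ => ?_
      congr 2
      abel
  have sP : ∑ k, p₀ k + ∑ k, p₁ k = 1 := by rw [← hp.2, sum_eq_sum_add_sum_coset he]
  have sQ : ∑ k, q₀ k + ∑ k, q₁ k = 1 := by rw [← hq.2, sum_eq_sum_add_sum_coset he]
  have mass₁ : ∑ k : K, conv p q (k + e) = binConv (∑ k, p₁ k) (∑ k, q₁ k) := by
    rw [show (∑ k : K, conv p q (k + e)) = ∑ k : K, (conv p₀ q₁ k + conv p₁ q₀ k) from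
      congrArg (fun f : K → ℝ => ∑ k, f k) r₁]
    rw [Finset.sum_add_distrib, sum_conv, sum_conv, binConv]
    rw [← eq_sub_iff_add_eq] at sP sQ
    rw [sP, sQ]
    ring
  have m₀ : massEntropy (conv p₀ q₀) + massEntropy (conv p₁ q₁) ≤
      massEntropy (fun k : K => conv p q k) := by
    rw [r₀, ← massEntropy_comp_equiv (Equiv.subRight (⟨e + e, hee⟩ : K)) (conv p₁ q₁)]
    exact massEntropy_add_le (conv_nonneg np₀ nq₀) fun k => conv_nonneg np₁ nq₁ _
  have m₁ : massEntropy (conv p₀ q₁) + massEntropy (conv p₁ q₀) ≤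
      massEntropy (fun k : K => conv p q (k + e)) := by
    rw [r₁]
    exact massEntropy_add_le (conv_nonneg np₀ nq₁) (conv_nonneg np₁ nq₀)
  have P₀n : 0 ≤ ∑ k, p₀ k := Finset.sum_nonneg fun k _ => np₀ k
  have P₁n : 0 ≤ ∑ k, p₁ k := Finset.sum_nonneg fun k _ => np₁ k
  have Q₀n : 0 ≤ ∑ k, q₀ k := Finset.sum_nonneg fun k _ => nq₀ k
  have Q₁n : 0 ≤ ∑ k, q₁ k := Finset.sum_nonneg fun k _ => nq₁ k
  have cancel : ∀ {f : K → ℝ}, (∀ k, 0 ≤ f k) →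
      (∑ k, f k) * (massEntropy f / ∑ k, f k) = massEntropy f := by
    intro f hf
    by_cases h : ∑ k, f k = 0
    · rw [h, zero_mul, massEntropy_of_sum_eq_zero hf h]
    · rw [mul_div_cancel₀ _ h]
  have jensen := gerberExt_jensen P₀n P₁n sP Q₀n Q₁n sQ
    (div_nonneg (massEntropy_nonneg np₀) P₀n) (div_nonneg (massEntropy_nonneg np₁) P₁n)
    (div_nonneg (massEntropy_nonneg nq₀) Q₀n) (div_nonneg (massEntropy_nonneg nq₁) Q₁n)
  rw [cancel np₀, cancel np₁, cancel nq₀, cancel nq₁] at jensen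
  have P₁m : ∑ k, p₁ k ∈ Icc (0 : ℝ) 1 := ⟨P₁n, by linarith⟩
  have Q₁m : ∑ k, q₁ k ∈ Icc (0 : ℝ) 1 := ⟨Q₁n, by linarith⟩
  have bin : ∀ {x : ℝ}, x ∈ Icc (0 : ℝ) 1 → binEntropy x ∈ Icc 0 (Real.log 2) := fun hx =>
    ⟨binEntropy_nonneg hx.1 hx.2, binEntropy_le_log_two⟩
  have step := gerberExt_add_le (bin P₁m) (bin Q₁m)
    (add_nonneg (massEntropy_nonneg np₀) (massEntropy_nonneg np₁))
    (add_nonneg (massEntropy_nonneg nq₀) (massEntropy_nonneg nq₁))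
  rw [gerber_binEntropy P₁m Q₁m] at step
  rw [entropy_eq_of_index_two he hp.2, entropy_eq_of_index_two he hq.2,
    entropy_eq_of_index_two he (hp.conv hq).2, mass₁]
  have b00 := hK.massEntropy_conv np₀ nq₀
  have b01 := hK.massEntropy_conv np₀ nq₁
  have b10 := hK.massEntropy_conv np₁ nq₀
  have b11 := hK.massEntropy_conv np₁ nq₁
  linarith

end Conv

/-- The entropy power inequality for groups of order `2 ^ n`, in terms of distributions. -/
theorem entropyBound_of_card (n : ℕ) : ∀ (G : Type*) [AddCommGroup G] [Fintype G],
    Fintype.card G = 2 ^ n → EntropyBound G := by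
  induction n with
  | zero =>
    intro G _ _ hG p q hp hq
    have hsub : Subsingleton G := Fintype.card_le_one_iff_subsingleton.1 (by simp [hG])
    have hz : ∀ r : G → ℝ, IsDistr r → entropy r = 0 := by
      intro r hr
      have h := hr.2
      rw [Fintype.sum_subsingleton _ (0 : G)] at h
      rw [entropy, Fintype.sum_subsingleton _ (0 : G), h, negMulLog_one]
    rw [hz p hp, hz q hq, hz _ (hp.conv hq), gerberExt_unit zero_mem_box zero_mem_box,
      gerber_zero_left zero_mem_box]
  | succ n ih =>
    intro G _ _ hG
    obtain ⟨K, hK⟩ : ∃ K : AddSubgroup G, Nat.card K = 2 ^ n := by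
      have : Fact (Nat.Prime 2) := ⟨Nat.prime_two⟩
      obtain ⟨K, hK⟩ := Sylow.exists_subgroup_card_pow_prime (G := Multiplicative G) 2 (n := n)
        (by rw [Nat.card_eq_fintype_card, Fintype.card_multiplicative, hG]
            exact pow_dvd_pow 2 n.le_succ)
      exact ⟨K.toAddSubgroup', hK⟩
    classical
    let _ : Fintype K := Fintype.ofFinite K
    refine EntropyBound.of_index_two (K := K) (ih K (by rw [← Nat.card_eq_fintype_card, hK])) ?_
    have h := K.card_mul_index
    rw [hK, Nat.card_eq_fintype_card, hG, pow_succ] at h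
    exact Nat.eq_of_mul_eq_mul_left (by positivity) h

/-! ### Distributions that are uniform on cosets -/

section Cosets

variable {G : Type*} [AddCommGroup G]

/-- The function `p` is supported on `K` and constant on the cosets of `L` in `K`: the counterpart
of `IsUniformOnCosets` for distributions. -/
def CosetUniform (p : G → ℝ) (L K : AddSubgroup G) : Prop :=
  (∀ g, g ∉ K → p g = 0) ∧ ∀ g ∈ K, ∀ l ∈ L, p (g + l) = p g

variable {L K : AddSubgroup G} {e : G} {p q : G → ℝ}

lemma CosetUniform.apply_add (hp : CosetUniform p L K) (hLK : L ≤ K) (g : G) {l : G}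
    (hl : l ∈ L) : p (g + l) = p g := by
  by_cases hg : g ∈ K
  · exact hp.2 g hg l hl
  · rw [hp.1 g hg, hp.1 (g + l) ((K.add_mem_cancel_right (hLK hl)).not.2 hg)]

lemma notMem_of_xor (he : ∀ b ∈ K, Xor (b + e ∈ L) (b ∈ L)) : e ∉ L := by
  intro h
  rcases he 0 K.zero_mem with h' | h'
  · exact h'.2 L.zero_mem
  · rw [zero_add] at h'
    exact h'.2 h

variable [Fintype G]

lemma sum_cosetUniform (hp : CosetUniform p L K) (hLK : L ≤ K) (heK : e ∈ K)
    (he : ∀ b ∈ K, Xor (b + e ∈ L) (b ∈ L)) :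
    ∑ g, p g = Nat.card L * (p 0 + p e) := by
  classical
  have hpt : ∀ g, p g = (if g ∈ L then p 0 else 0) + if g - e ∈ L then p e else 0 := by
    intro g
    by_cases hg : g ∈ K
    · have hx := he (g - e) (K.sub_mem hg heK)
      rw [sub_add_cancel] at hx
      rcases hx with ⟨h1, h2⟩ | ⟨h1, h2⟩
      · rw [if_pos h1, if_neg h2, add_zero, ← hp.apply_add hLK 0 h1, zero_add]
      · rw [if_neg h2, if_pos h1, zero_add, ← hp.apply_add hLK e h1, add_sub_cancel]
    · have h1 : g ∉ L := fun h => hg (hLK h)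
      have h2 : g - e ∉ L := fun h => hg (by simpa using K.add_mem (hLK h) heK)
      rw [if_neg h1, if_neg h2, hp.1 g hg, add_zero]
  have hcard : ∀ c : ℝ, (∑ g, if g ∈ L then c else 0) = Nat.card L * c := by
    intro c
    rw [← Finset.sum_filter, Finset.sum_const, nsmul_eq_mul, Nat.card_eq_fintype_card,
      Fintype.card_subtype]
  have hshift := Equiv.sum_comp (Equiv.subRight e) (fun g => if g ∈ L then p e else 0)
  simp only [Equiv.subRight_apply] at hshift
  rw [Finset.sum_congr rfl fun g _ => hpt g, Finset.sum_add_distrib, hcard, hshift, hcard]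
  ring

lemma entropy_cosetUniform (hp : CosetUniform p L K) (hd : IsDistr p) (hLK : L ≤ K) (heK : e ∈ K)
    (he : ∀ b ∈ K, Xor (b + e ∈ L) (b ∈ L)) :
    entropy p = binEntropy (Nat.card L * p e) + Real.log (Nat.card L) := by
  have h1 := hd.2
  rw [sum_cosetUniform hp hLK heK he] at h1
  have hn : CosetUniform (fun g => negMulLog (p g)) L K :=
    ⟨fun g hg => by simp only [hp.1 g hg, negMulLog_zero],
      fun g hg l hl => by simp only [hp.2 g hg l hl]⟩
  rw [entropy, sum_cosetUniform hn hLK heK he, binEntropy_eq_negMulLog_add_negMulLog_one_sub,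
    show 1 - Nat.card L * p e = Nat.card L * p 0 by rw [← h1]; ring, negMulLog_mul, negMulLog_mul]
  rw [show negMulLog (Nat.card L : ℝ) = -(Nat.card L) * Real.log (Nat.card L) from rfl]
  linear_combination Real.log (Nat.card L) * h1

lemma card_mul_mem_Icc (hp : CosetUniform p L K) (hd : IsDistr p) (hLK : L ≤ K) (heK : e ∈ K)
    (he : ∀ b ∈ K, Xor (b + e ∈ L) (b ∈ L)) : Nat.card L * p e ∈ Icc (0 : ℝ) 1 := by
  have h1 := hd.2
  rw [sum_cosetUniform hp hLK heK he] at h1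
  have h2 : 0 ≤ Nat.card L * p 0 := mul_nonneg (Nat.cast_nonneg _) (hd.1 0)
  exact ⟨mul_nonneg (Nat.cast_nonneg _) (hd.1 e), by linarith⟩

lemma CosetUniform.conv (hp : CosetUniform p L K) (hq : CosetUniform q L K) (hLK : L ≤ K) :
    CosetUniform (conv p q) L K := by
  refine ⟨fun g hg => Finset.sum_eq_zero fun a _ => ?_, fun g _ l hl => ?_⟩
  · by_cases ha : a ∈ K
    · rw [hq.1 (g - a) fun h => hg (by simpa using K.add_mem h ha), mul_zero]
    · rw [hp.1 a ha, zero_mul]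
  · refine Finset.sum_congr rfl fun a _ => ?_
    rw [add_sub_right_comm, hq.apply_add hLK _ hl]

/-- Modulo `L`, the convolution is that of two distributions on a group of order `2`. -/
lemma entropy_conv_cosetUniform (hp : CosetUniform p L K) (hq : CosetUniform q L K)
    (hdp : IsDistr p) (hdq : IsDistr q) (hLK : L ≤ K) (heK : e ∈ K)
    (he : ∀ b ∈ K, Xor (b + e ∈ L) (b ∈ L)) :
    entropy (conv p q) = gerber (entropy p - Real.log (Nat.card L))
      (entropy q - Real.log (Nat.card L)) + Real.log (Nat.card L) := by
  have hee : e + e ∈ L := (he e heK).or.resolve_right (notMem_of_xor he)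
  have hf : CosetUniform (fun a => p a * q (0 - a)) L K := by
    refine ⟨fun g hg => by simp only [hp.1 g hg, zero_mul], fun g hg l hl => ?_⟩
    dsimp only
    rw [hp.2 g hg l hl, show 0 - (g + l) = 0 - g + -l by abel, hq.apply_add hLK _ (L.neg_mem hl)]
  have h0 : MrsGerber.conv p q 0 = Nat.card L * (p 0 * q 0 + p e * q e) := by
    rw [MrsGerber.conv, sum_cosetUniform hf hLK heK he, sub_zero, zero_sub,
      ← hq.apply_add hLK (-e) hee, neg_add_cancel_left]
  have hd := hdp.conv hdq
  have hr := hp.conv hq hLK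
  have s1 := hdp.2
  have s2 := hdq.2
  have s3 := hd.2
  rw [sum_cosetUniform hp hLK heK he] at s1
  rw [sum_cosetUniform hq hLK heK he] at s2
  rw [sum_cosetUniform hr hLK heK he, h0] at s3
  rw [entropy_cosetUniform hp hdp hLK heK he, entropy_cosetUniform hq hdq hLK heK he,
    entropy_cosetUniform hr hd hLK heK he, add_sub_cancel_right, add_sub_cancel_right,
    gerber_binEntropy (card_mul_mem_Icc hp hdp hLK heK he) (card_mul_mem_Icc hq hdq hLK heK he)]
  congr 2
  set N : ℝ := (Nat.card L : ℝ)
  have e1 : N * p 0 = 1 - N * p e := by linarith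
  have e2 : N * q 0 = 1 - N * q e := by linarith
  have e3 : N * (N * (p 0 * q 0 + p e * q e)) =
      (1 - N * p e) * (1 - N * q e) + (N * p e) * (N * q e) := by
    rw [← e1, ← e2]
    ring
  rw [binConv]
  linarith

/-- Adding an independent variable with values in a subgroup under which the law of the other one
is invariant does not change that law. -/
lemma conv_eq_right {L' K' : AddSubgroup G} (hp : CosetUniform p L K) (hd : IsDistr p)
    (hq : CosetUniform q L' K') (hLK' : L' ≤ K') (hK : K ≤ L') : conv p q = q := by
  funext g
  have : ∀ a, p a * q (g - a) = p a * q g := by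
    intro a
    by_cases ha : a ∈ K
    · rw [sub_eq_add_neg, hq.apply_add hLK' _ (L'.neg_mem (hK ha))]
    · rw [hp.1 a ha, zero_mul, zero_mul]
  rw [conv, Finset.sum_congr rfl fun a _ => this a, ← Finset.sum_mul, hd.2, one_mul]

end Cosets

/-! ### Chains of subgroups -/

section Chain

variable {G : Type*} [AddCommGroup G] {n : ℕ}

variable {c : ℕ → AddSubgroup G}

lemma exists_coset_rep (hc : Monotone c) (hcard : ∀ k ≤ n, Nat.card (c k) = 2 ^ k) {k : ℕ}
    (hk : k < n) : ∃ e ∈ c (k + 1), ∀ b ∈ c (k + 1), Xor (b + e ∈ c k) (b ∈ c k) := by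
  rw [← AddSubgroup.relIndex_eq_two_iff]
  have h := AddSubgroup.relIndex_mul_relIndex ⊥ _ _ bot_le (hc k.le_succ)
  rw [AddSubgroup.relIndex_bot_left, AddSubgroup.relIndex_bot_left, Nat.succ_eq_add_one,
    hcard k hk.le, hcard (k + 1) hk, pow_succ] at h
  exact Nat.eq_of_mul_eq_mul_left (by positivity) h

lemma log_card_chain (hcard : ∀ k ≤ n, Nat.card (c k) = 2 ^ k) {k : ℕ} (hk : k < n) :
    Real.log (Nat.card (c k)) = k * Real.log 2 := by
  rw [hcard k hk.le]
  push_cast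
  rw [Real.log_pow]

variable [Fintype G]

lemma exists_chain (hG : Fintype.card G = 2 ^ n) :
    ∃ c : ℕ → AddSubgroup G, Monotone c ∧ ∀ k ≤ n, Nat.card (c k) = 2 ^ k := by
  have : Fact (Nat.Prime 2) := ⟨Nat.prime_two⟩
  suffices h : ∀ m ≤ n, ∃ c : ℕ → AddSubgroup G, Monotone c ∧
      ∀ k ≤ m, Nat.card (c k) = 2 ^ k from h n le_rfl
  intro m
  induction m with
  | zero =>
    intro _
    refine ⟨fun _ => ⊥, monotone_const, fun k hk => ?_⟩
    obtain rfl : k = 0 := by omega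
    simp
  | succ m ih =>
    intro hm
    obtain ⟨c, hc, hcard⟩ := ih (by omega)
    obtain ⟨K, hK, hle⟩ := Sylow.exists_subgroup_card_pow_prime_le (G := Multiplicative G) 2
      (n := m) (m := m + 1)
      (by rw [Nat.card_eq_fintype_card, Fintype.card_multiplicative, hG]
          exact pow_dvd_pow 2 hm)
      (AddSubgroup.toSubgroup (c m)) (hcard m le_rfl) (by omega)
    have hle' : c m ≤ K.toAddSubgroup' := fun g hg => hle hg
    refine ⟨fun k => if k ≤ m then c k else K.toAddSubgroup', fun i j hij => ?_, fun k hk => ?_⟩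
    · dsimp only
      split_ifs with h1 h2
      · exact hc hij
      · exact (hc h1).trans hle'
      · omega
      · exact le_rfl
    · dsimp only
      split_ifs with h1
      · exact hcard k h1
      · obtain rfl : k = m + 1 := by omega
        exact hK

lemma exists_cosetUniform (hc : Monotone c) (hcard : ∀ k ≤ n, Nat.card (c k) = 2 ^ k) {k : ℕ}
    (hk : k < n) {x : ℝ} (hx : x ∈ logBox k) :
    ∃ p : G → ℝ, IsDistr p ∧ CosetUniform p (c k) (c (k + 1)) ∧ entropy p = x := by
  classical
  obtain ⟨e, heK, he⟩ := exists_coset_rep hc hcard hk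
  obtain ⟨ha, hb⟩ := binEntropyInv_spec (sub_mem_of_mem_logBox hx)
  set a := binEntropyInv (x - k * Real.log 2)
  have hN : (0 : ℝ) < Nat.card (c k) := by exact_mod_cast Nat.card_pos
  set N : ℝ := (Nat.card (c k) : ℝ) with hNdef
  set p : G → ℝ := fun g => if g ∈ c k then (1 - a) / N else if g ∈ c (k + 1) then a / N else 0
  have hle := hc k.le_succ
  have hp : CosetUniform p (c k) (c (k + 1)) := by
    refine ⟨fun g hg => ?_, fun g hg l hl => ?_⟩
    · simp only [p]
      rw [if_neg fun h => hg (hle h), if_neg hg]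
    · simp only [p]
      rw [AddSubgroup.add_mem_cancel_right _ hl, AddSubgroup.add_mem_cancel_right _ (hle hl)]
  have p0 : p 0 = (1 - a) / N := if_pos (c k).zero_mem
  have pe : p e = a / N := by
    simp only [p]
    rw [if_neg (notMem_of_xor he), if_pos heK]
  have hd : IsDistr p := by
    refine ⟨fun g => ?_, ?_⟩
    · simp only [p]
      have h1 : 0 ≤ 1 - a := by linarith [ha.2]
      have h2 := ha.1
      split_ifs <;> positivity
    · rw [sum_cosetUniform hp hle heK he, p0, pe, ← hNdef]
      field_simp
      ring
  refine ⟨p, hd, hp, ?_⟩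
  rw [entropy_cosetUniform hp hd hle heK he, pe, ← hNdef, mul_div_cancel₀ _ hN.ne', hb, hNdef,
    log_card_chain hcard hk, sub_add_cancel]

/-- Laws that are uniform on cosets along a common chain attain the explicit bound. -/
lemma entropy_conv_chain (hc : Monotone c) (hcard : ∀ k ≤ n, Nat.card (c k) = 2 ^ k) {k j : ℕ}
    (hk : k < n) (hj : j < n) {p q : G → ℝ} (hdp : IsDistr p) (hdq : IsDistr q)
    (hp : CosetUniform p (c k) (c (k + 1))) (hq : CosetUniform q (c j) (c (j + 1)))
    (hx : entropy p ∈ logBox k) (hy : entropy q ∈ logBox j) :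
    entropy (conv p q) = gerberExt (entropy p) (entropy q) := by
  have cast_le : ∀ {i l : ℕ}, i < l → ((i : ℝ) + 1) * Real.log 2 ≤ l * Real.log 2 := fun h =>
    mul_le_mul_of_nonneg_right (by exact_mod_cast h) log_two_nonneg
  rcases lt_trichotomy k j with h | rfl | h
  · rw [conv_eq_right hp hdp hq (hc j.le_succ) (hc h),
      gerberExt_of_le_of_le (entropy_nonneg hdp) (hx.2.trans (cast_le h)) hy.1]
  · obtain ⟨e, heK, he⟩ := exists_coset_rep hc hcard hk
    rw [entropy_conv_cosetUniform hp hq hdp hdq (hc k.le_succ) heK he, log_card_chain hcard hk,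
      gerberExt_of_mem_logBox hx hy]
  · rw [conv_comm, conv_eq_right hq hdq hp (hc k.le_succ) (hc h),
      gerberExt_of_le_of_le' (entropy_nonneg hdq) (hy.2.trans (cast_le h)) hx.1]

lemma exists_lt_mem_logBox (hn : n ≠ 0) {x : ℝ} (hx : x ∈ Icc (0 : ℝ) (n * Real.log 2)) :
    ∃ k < n, x ∈ logBox k := by
  rcases hx.2.lt_or_eq with h | h
  · refine ⟨⌊x / Real.log 2⌋₊, ?_, mem_logBox_floor hx.1⟩
    have h' := (floor_mul_log_le hx.1).trans_lt h
    exact_mod_cast lt_of_mul_lt_mul_right h' log_two_nonneg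
  · obtain ⟨m, rfl⟩ := Nat.exists_eq_succ_of_ne_zero hn
    refine ⟨m, m.lt_succ_self, ?_⟩
    push_cast at h
    rw [h]
    exact ⟨mul_le_mul_of_nonneg_right (by linarith) log_two_nonneg, le_rfl⟩

lemma exists_entropy_conv_eq (hG : Fintype.card G = 2 ^ n) {x y : ℝ}
    (hx : x ∈ Icc (0 : ℝ) (n * Real.log 2)) (hy : y ∈ Icc (0 : ℝ) (n * Real.log 2)) :
    ∃ p q : G → ℝ, IsDistr p ∧ IsDistr q ∧ entropy p = x ∧ entropy q = y ∧
      entropy (conv p q) = gerberExt x y := by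
  rcases eq_or_ne n 0 with rfl | hn
  · have hx0 : x = 0 := by simpa using hx
    have hy0 : y = 0 := by simpa using hy
    have hG' : Fintype.card G = 1 := by simpa using hG
    have h1 : ∀ f : G → ℝ, (∀ g, f g = 1) → IsDistr f ∧ entropy f = 0 := fun f hf =>
      ⟨⟨fun g => by simp [hf], by simp [hf, hG']⟩, by simp [entropy, hf]⟩
    obtain ⟨h2, h3⟩ := h1 (fun _ => 1) fun _ => rfl
    refine ⟨_, _, h2, h2, by rw [h3, hx0], by rw [h3, hy0], ?_⟩
    rw [hx0, hy0, gerberExt_unit zero_mem_box zero_mem_box, gerber_zero_left zero_mem_box]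
    exact (h1 _ fun g => by simp [conv, hG']).2
  obtain ⟨c, hc, hcard⟩ := exists_chain hG
  obtain ⟨k, hk, hxk⟩ := exists_lt_mem_logBox hn hx
  obtain ⟨j, hj, hyj⟩ := exists_lt_mem_logBox hn hy
  obtain ⟨p, hdp, hp, rfl⟩ := exists_cosetUniform hc hcard hk hxk
  obtain ⟨q, hdq, hq, rfl⟩ := exists_cosetUniform hc hcard hj hyj
  exact ⟨p, q, hdp, hdq, rfl, rfl, entropy_conv_chain hc hcard hk hj hdp hdq hp hq hxk hyj⟩

end Chain

/-! ### Random variables -/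

section RandomVariables

variable {Ω : Type*} [MeasurableSpace Ω] {P : Measure Ω} [IsProbabilityMeasure P]

/-- The law of a random variable with values in a finite set, as a function. -/
def law {G : Type*} (P : Measure Ω) (X : Ω → G) (g : G) : ℝ := P.real (X ⁻¹' {g})

variable {G : Type*} [Fintype G]

lemma isDistr_law {X : Ω → G} (hX : Measurable[_, ⊤] X) : IsDistr (law P X) := by
  let _ : MeasurableSpace G := ⊤
  refine ⟨fun g => measureReal_nonneg, ?_⟩
  have h := sum_measureReal_preimage_singleton (μ := P) (f := X) Finset.univ
    fun g _ => hX (measurableSet_singleton g)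
  simpa [law] using h

lemma law_add [AddCommGroup G] {X Y : Ω → G} (h : IsIndepPair P X Y) :
    law P (fun ω => X ω + Y ω) = conv (law P X) (law P Y) := by
  let _ : MeasurableSpace G := ⊤
  obtain ⟨hX, hY, hXY⟩ := h
  have hms : ∀ s : Set G, MeasurableSet s := fun s => MeasurableSpace.measurableSet_top
  funext g
  have hset : (fun ω => X ω + Y ω) ⁻¹' {g} = ⋃ a : G, X ⁻¹' {a} ∩ Y ⁻¹' {g - a} := by
    ext ω
    simp [eq_sub_iff_add_eq, add_comm]
  rw [law, hset, measureReal_iUnion_fintype]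
  · refine Finset.sum_congr rfl fun a _ => ?_
    simp only [law, measureReal_def]
    rw [hXY.measure_inter_preimage_eq_mul _ _ (hms _) (hms _), ENNReal.toReal_mul]
  · intro a b hab
    refine Disjoint.mono inter_subset_left inter_subset_left ?_
    exact Disjoint.preimage X (by simpa using hab)
  · exact fun a => (hX (hms _)).inter (hY (hms _))

end RandomVariables

lemma exists_measure_of_isDistr {ι : Type*} [Fintype ι] [MeasurableSpace ι]
    [MeasurableSingletonClass ι] {p : ι → ℝ} (hp : IsDistr p) :
    ∃ μ : Measure ι, IsProbabilityMeasure μ ∧ ∀ i, μ.real {i} = p i := by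
  have hs : ∑ i, ENNReal.ofReal (p i) = 1 := by
    rw [← ENNReal.ofReal_sum_of_nonneg fun i _ => hp.1 i, hp.2, ENNReal.ofReal_one]
  refine ⟨(PMF.ofFintype _ hs).toMeasure, inferInstance, fun i => ?_⟩
  rw [measureReal_def, PMF.toMeasure_apply_singleton _ _ (measurableSet_singleton i),
    PMF.ofFintype_apply, ENNReal.toReal_ofReal (hp.1 i)]

/-- Any two distributions on `G` are the laws of independent random variables. The probability space
is built on `Fin (card G)`, so that it lies in the lowest universe. -/
lemma exists_isIndepPair {G : Type*} [Fintype G] {p q : G → ℝ} (hp : IsDistr p)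
    (hq : IsDistr q) :
    ∃ (Ω : Type) (_ : MeasurableSpace Ω) (P : Measure Ω) (X Y : Ω → G),
      IsProbabilityMeasure P ∧ IsIndepPair P X Y ∧ law P X = p ∧ law P Y = q := by
  let e := (Fintype.equivFin G).symm
  have hpull : ∀ {r : G → ℝ}, IsDistr r → IsDistr fun i => r (e i) := fun {r} hr =>
    ⟨fun i => hr.1 _, by rw [← hr.2]; exact Equiv.sum_comp e r⟩
  obtain ⟨μ, hμ, hμp⟩ := exists_measure_of_isDistr (hpull hp)
  obtain ⟨ν, hν, hνq⟩ := exists_measure_of_isDistr (hpull hq)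
  have hset : ∀ g, e ⁻¹' {g} = {e.symm g} := fun g => by
    ext i
    simp [Equiv.eq_symm_apply]
  refine ⟨Fin (Fintype.card G) × Fin (Fintype.card G), inferInstance, μ.prod ν,
    fun ω => e ω.1, fun ω => e ω.2, inferInstance, ?_, ?_, ?_⟩
  · let _ : MeasurableSpace G := ⊤
    have he : Measurable e := measurable_of_countable e
    exact ⟨he.comp measurable_fst, he.comp measurable_snd, indepFun_prod he he⟩
  · funext g
    rw [law, show (fun ω : Fin (Fintype.card G) × Fin (Fintype.card G) => e ω.1) ⁻¹' {g} =
      {e.symm g} ×ˢ univ by rw [← hset]; ext ω; simp]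
    rw [measureReal_prod_prod, hμp]
    simp
  · funext g
    rw [law, show (fun ω : Fin (Fintype.card G) × Fin (Fintype.card G) => e ω.2) ⁻¹' {g} =
      univ ×ˢ {e.symm g} by rw [← hset]; ext ω; simp]
    rw [measureReal_prod_prod, hνq]
    simp

/-! ### The minimum -/

section Minimum

variable {n : ℕ} {G : Type*} [AddCommGroup G] [Fintype G]

lemma gerberExt_le_shannonEntropy_add (hG : Fintype.card G = 2 ^ n) {Ω : Type*}
    [MeasurableSpace Ω] {P : Measure Ω} [IsProbabilityMeasure P] {X Y : Ω → G}
    (h : IsIndepPair P X Y) :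
    gerberExt (shannonEntropy P X) (shannonEntropy P Y) ≤
      shannonEntropy P (fun ω => X ω + Y ω) := by
  have hle := entropyBound_of_card n G hG (law P X) (law P Y) (isDistr_law h.1)
    (isDistr_law h.2.1)
  rwa [← law_add h] at hle

lemma isLeast_gerberExt (hG : Fintype.card G = 2 ^ n) {x y : ℝ}
    (hx : x ∈ Icc (0 : ℝ) (n * Real.log 2)) (hy : y ∈ Icc (0 : ℝ) (n * Real.log 2)) :
    IsLeast (sumEntropies G x y) (gerberExt x y) := by
  constructor
  · obtain ⟨p, q, hp, hq, ex, ey, es⟩ := exists_entropy_conv_eq hG hx hy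
    obtain ⟨Ω, _, P, X, Y, hP, hXY, rfl, rfl⟩ := exists_isIndepPair hp hq
    refine ⟨Ω, _, P, X, Y, hP, hXY, ex, ey, ?_⟩
    rw [← es, ← law_add hXY]
    rfl
  · rintro s ⟨Ω, _, P, X, Y, hP, hXY, rfl, rfl, rfl⟩
    exact gerberExt_le_shannonEntropy_add hG hXY

lemma minSumEntropy_eq (hG : Fintype.card G = 2 ^ n) {x y : ℝ}
    (hx : x ∈ Icc (0 : ℝ) (n * Real.log 2)) (hy : y ∈ Icc (0 : ℝ) (n * Real.log 2)) :
    minSumEntropy G x y = gerberExt x y :=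
  (isLeast_gerberExt hG hx hy).csInf_eq

lemma minSumEntropy_zmod_two {u v : ℝ} (hu : u ∈ Icc 0 (Real.log 2))
    (hv : v ∈ Icc 0 (Real.log 2)) : minSumEntropy (ZMod 2) u v = gerber u v := by
  rw [minSumEntropy_eq (n := 1) (ZMod.card 2) (by simpa using hu) (by simpa using hv),
    gerberExt_unit hu hv]

lemma shannonEntropy_mem (hG : Fintype.card G = 2 ^ n) {Ω : Type*} [MeasurableSpace Ω]
    {P : Measure Ω} [IsProbabilityMeasure P] {X : Ω → G} (hX : Measurable[_, ⊤] X) :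
    shannonEntropy P X ∈ Icc (0 : ℝ) (n * Real.log 2) := by
  refine ⟨entropy_nonneg (isDistr_law hX), (entropy_le_log_card (isDistr_law hX)).trans_eq ?_⟩
  rw [hG]
  push_cast
  rw [Real.log_pow]

end Minimum

lemma mem_Icc_of_mem_logBox {n k : ℕ} (hk : k < n) {x : ℝ} (hx : x ∈ logBox k) :
    x ∈ Icc (0 : ℝ) (n * Real.log 2) :=
  ⟨nonneg_of_mem_logBox hx,
    hx.2.trans (mul_le_mul_of_nonneg_right (by exact_mod_cast hk) log_two_nonneg)⟩

end MrsGerber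

end

theorem theorem5p2 (n : ℕ) (G : Type*) [AddCommGroup G] [Fintype G]
    (hG : Fintype.card G = 2 ^ n) :
    -- the minimum exists, equals that of the cyclic group, depends only on the order of the
    -- group, and is given by the explicit formula
    (∀ x ∈ Set.Icc (0 : ℝ) (n * Real.log 2), ∀ y ∈ Set.Icc (0 : ℝ) (n * Real.log 2),
      IsLeast (sumEntropies G x y) (minSumEntropy G x y) ∧
      minSumEntropy G x y = minSumEntropy (ZMod (2 ^ n)) x y ∧
      (∀ (G' : Type*) [AddCommGroup G'] [Fintype G'], Fintype.card G' = Fintype.card G →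
        minSumEntropy G' x y = minSumEntropy G x y) ∧
      (∀ k : ℕ, x ∈ logBox k → y ∈ logBox k →
        minSumEntropy G x y =
          minSumEntropy (ZMod 2) (x - k * Real.log 2) (y - k * Real.log 2) + k * Real.log 2) ∧
      ((∀ k : ℕ, ¬ (x ∈ logBox k ∧ y ∈ logBox k)) → minSumEntropy G x y = max x y)) ∧
    -- the two-element group
    (∀ u ∈ Set.Icc (0 : ℝ) (Real.log 2), ∀ v ∈ Set.Icc (0 : ℝ) (Real.log 2),
      minSumEntropy (ZMod 2) u v =
        Real.binEntropy (binConv (binEntropyInv u) (binEntropyInv v))) ∧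
    -- the entropy power inequality
    (∀ (Ω : Type*) [MeasurableSpace Ω] (P : Measure Ω) [IsProbabilityMeasure P] (X Y : Ω → G),
      IsIndepPair P X Y →
        shannonEntropy P X ∈ Set.Icc (0 : ℝ) (n * Real.log 2) ∧
        shannonEntropy P Y ∈ Set.Icc (0 : ℝ) (n * Real.log 2) ∧
        minSumEntropy G (shannonEntropy P X) (shannonEntropy P Y) ≤
          shannonEntropy P (fun ω => X ω + Y ω)) ∧
    -- extremizers: there is a chain of subgroups of orders 1, 2, 4, …, 2 ^ n, and along every such
    -- chain the laws that are uniform on cosets realize all entropies and attain the minimum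
    (∃ c : ℕ → AddSubgroup G, Monotone c ∧ ∀ k ≤ n, Nat.card (c k) = 2 ^ k) ∧
    (∀ c : ℕ → AddSubgroup G, Monotone c → (∀ k ≤ n, Nat.card (c k) = 2 ^ k) →
      ∀ k < n, ∀ j < n, ∀ x ∈ logBox k, ∀ y ∈ logBox j,
        (∃ (Ω : Type) (_ : MeasurableSpace Ω) (P : Measure Ω) (X Y : Ω → G),
          IsProbabilityMeasure P ∧ IsIndepPair P X Y ∧
          IsUniformOnCosets P X (c k) (c (k + 1)) ∧ IsUniformOnCosets P Y (c j) (c (j + 1)) ∧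
          shannonEntropy P X = x ∧ shannonEntropy P Y = y) ∧
        (∀ (Ω : Type*) [MeasurableSpace Ω] (P : Measure Ω) [IsProbabilityMeasure P]
          (X Y : Ω → G), IsIndepPair P X Y →
          IsUniformOnCosets P X (c k) (c (k + 1)) → IsUniformOnCosets P Y (c j) (c (j + 1)) →
          shannonEntropy P X = x → shannonEntropy P Y = y →
          shannonEntropy P (fun ω => X ω + Y ω) = minSumEntropy G x y)) := by
  have hF : ∀ {x y : ℝ}, x ∈ Set.Icc (0 : ℝ) (n * Real.log 2) →
      y ∈ Set.Icc (0 : ℝ) (n * Real.log 2) → minSumEntropy G x y = MrsGerber.gerberExt x y :=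
    fun hx hy => MrsGerber.minSumEntropy_eq hG hx hy
  refine ⟨fun x hx y hy => ⟨?_, ?_, fun G' _ _ hG' => ?_, fun k hxk hyk => ?_, fun hne => ?_⟩,
    fun u hu v hv => MrsGerber.minSumEntropy_zmod_two hu hv, fun Ω _ P _ X Y h => ?_,
    MrsGerber.exists_chain hG, fun c hc hcard k hk j hj x hx y hy => ⟨?_, ?_⟩⟩
  · rw [hF hx hy]
    exact MrsGerber.isLeast_gerberExt hG hx hy
  · rw [hF hx hy, MrsGerber.minSumEntropy_eq (ZMod.card (2 ^ n)) hx hy]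
  · rw [hF hx hy, MrsGerber.minSumEntropy_eq (hG'.trans hG) hx hy]
  · rw [hF hx hy, MrsGerber.gerberExt_of_mem_logBox hxk hyk,
      MrsGerber.minSumEntropy_zmod_two (MrsGerber.sub_mem_of_mem_logBox hxk)
        (MrsGerber.sub_mem_of_mem_logBox hyk)]
  · rw [hF hx hy]
    rcases MrsGerber.box_or_separated hx.1 hy.1 with ⟨k, h⟩ | ⟨k, h1, h2⟩ | ⟨k, h1, h2⟩
    · exact absurd h (hne k)
    · rw [MrsGerber.gerberExt_of_le_of_le hx.1 h1 h2, max_eq_right (h1.trans h2)]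
    · rw [MrsGerber.gerberExt_of_le_of_le' hy.1 h1 h2, max_eq_left (h1.trans h2)]
  · have hX := MrsGerber.shannonEntropy_mem (P := P) hG h.1
    have hY := MrsGerber.shannonEntropy_mem (P := P) hG h.2.1
    refine ⟨hX, hY, ?_⟩
    rw [hF hX hY]
    exact MrsGerber.gerberExt_le_shannonEntropy_add hG h
  · obtain ⟨p, hdp, hp, ex⟩ := MrsGerber.exists_cosetUniform hc hcard hk hx
    obtain ⟨q, hdq, hq, ey⟩ := MrsGerber.exists_cosetUniform hc hcard hj hy
    obtain ⟨Ω, _, P, X, Y, hP, hXY, rfl, rfl⟩ := MrsGerber.exists_isIndepPair hdp hdq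
    exact ⟨Ω, _, P, X, Y, hP, hXY, hp, hq, ex, ey⟩
  · intro Ω _ P _ X Y h hX hY ex ey
    subst ex ey
    rw [hF (MrsGerber.mem_Icc_of_mem_logBox hk hx) (MrsGerber.mem_Icc_of_mem_logBox hj hy)]
    have hs := MrsGerber.entropy_conv_chain hc hcard hk hj (MrsGerber.isDistr_law h.1)
      (MrsGerber.isDistr_law h.2.1) hX hY hx hy
    rw [← MrsGerber.law_add h] at hs
    exact hs
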